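/- **Setting.** A finite tiling of square $\varepsilon$-cells is divided into obstacle, forbidden and allowed cells (unknown to the robots), and is grouped into $M$ disjoint tasks; the union of the allowed cells is the free space. Any two allowed cells are joined by a chain of edge-adjacent allowed cells. $N$ robots start on allowed cells with an arbitrary initial task allocation; every robot detects obstacle and forbidden cells next to it, and possibly others within the range $r_s\ge\varepsilon$ of its sensor. The robots communicate perfectly and share a symbolic map. Let $n_U(r)$ be the number of unexplored cells of task $r$: those neither explored, nor known to be blocked, nor closed off from the robots by cells known to be blocked. **The CARE algorithm.** Each robot is controlled by a discrete event supervisor with states Start, Working, No-idling Game, Resilience Game, Idle, Failed, Stop ($ST,WK,NG,RG,ID,FL,SP$), and events: turned on ($ST\to WK$); a neighbour failed ($WK,ID\to RG$); own task completed ($WK\to NG$); called by a neighbour that completed its task ($WK,ID\to NG$); a task is assigned ($NG,RG\to WK$); no task is assigned ($NG,RG\to ID$); $\sum_r n_U(r)=0$ ($ID\to SP$); own failure (any state but $SP,FL$ $\to FL$). A working robot covers its task, or its sub-region if the task is shared, with the single-robot $\epsilon^\star$ algorithm (waypoints from multiscale potential surfaces). At most one robot at a time works in each of the $n_{\max}$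 sub-regions of a shared task. Let $t_c(r)$ be the time needed to complete task $r$ by its assigned robots, i.e. $t_c(r)=n_U(r)/(\omega a)$ with $a$ the number of robots assigned to $r$ now or next (a failed robot counts until its failure is detected), which is $+\infty$ for an incomplete task with $a=0$ and $0$ for a completed one. * When a robot completes its task, a *no-idling game* is played by this robot and those of its $\kappa_1$ nearest neighbours whose current task has $t_c\le\eta$, over the tasks with $t_c(r)\ge\gamma$. If there is no such task, players with no work left become idle. * When the failure of a robot is detected (a time $T_0$ after it occurs) and no other robot is at work in its task, a *resilience game* is played by its $\kappa_2$ nearest neighbours, over the task of the failed robot and those current tasks of the players with $t_c>\eta$. Games are played one at a time by $L$ cycles of Max-Logit (learning parameter $\tau$). Utilities are marginal contributions to $\phi(a)=\sum_r w_r\bigl(1-\prod_{i:a_i=r}(1-p_r(i))\bigr)$, with $p_r(i)$ the battery reliability $1/(1+e^{\rho_0(t-\rho_1)})$ of robot $i$ at the predicted completion time, and $w_r$ the expected number of undiscovered targets (Poisson prior of mean $\lambda_r$) available to the players. Afterwards each live player is assigned its final action; a player with $t_c\le\eta$ for its current task finishes that task first. All parameters $\varepsilon,u,\omega,\eta,\gamma,\tau,\kappa_1,\kappa_2,L,n_{\max}$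 and the exogenous potentials are positive. At every time any set of robots may fail. **Theorem.** The algorithm can always start and never blocks: an initial configuration exists, and from every configuration a next step is possible. In every run (for every pattern of failures, every tie-breaking, and every outcome of the random choices that has positive probability) in which at least one robot never fails, there is a finite time $K$ such that 1. the cells explored by the robots up to time $K$ jointly cover the free space, and $\sum_{r=1}^M n_U(r)=0$ at time $K$; 2. from time $K$ on, the supervisor of every robot that has not failed is in the terminal state $SP$. -/

import Mathlib

namespace CARE

noncomputable section

open scoped Classical ENNReal

/-! ### The discrete event supervisor -/

/-- States of the supervisor: start, working, no-idling game, resilience game, idle, failed,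
stop. -/
inductive DState
  | ST | WK | NG | RG | ID | FL | SP

/-- Events: `e0` turned on, `e1` a neighbour failed, `e2` own task completed, `e3` a (new or
current) task is assigned, `e4` no task is assigned, `e5` called by a neighbour which has just
completed its task, `e6` the whole area is covered, `e7` own failure. -/
inductive DEvent
  | e0 | e1 | e2 | e3 | e4 | e5 | e6 | e7

open DState DEvent

/-- The partial transition function of the supervisor. -/
def delta : DState → DEvent → Option DState
  | .ST, e0 => some WK
  | WK, e1 => some RG
  | ID, e1 => some RG
  | WK, e2 => some NG
  | NG, e3 => some WK
  | RG, e3 => some WK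
  | NG, e4 => some ID
  | RG, e4 => some ID
  | WK, e5 => some NG
  | ID, e5 => some NG
  | ID, e6 => some SP
  | .ST, e7 => some FL
  | WK, e7 => some FL
  | NG, e7 => some FL
  | RG, e7 => some FL
  | ID, e7 => some FL
  | _, _ => none

/-- The state after an event; an event that is not enabled has no effect. -/
def fire (e : DEvent) (x : DState) : DState := (delta x e).getD x

/-- The marked states. -/
def marked : Set DState := {SP, FL}

/-! ### The mission -/

/-- Index `(i, j)` of the square cell `[iε, (i+1)ε] × [jε, (j+1)ε]`. -/
abbrev Cell := ℤ × ℤ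

abbrev Plane := EuclideanSpace ℝ (Fin 2)

inductive CellKind
  | obstacle | forbidden | allowed

/-- Two cells share an edge. -/
def edgeAdj (a b : Cell) : Prop := |a.1 - b.1| + |a.2 - b.2| = 1

/-- The graph of the cells of `S`, with an edge when two of them share an edge. -/
def cellGraph (S : Finset Cell) : SimpleGraph Cell where
  Adj a b := a ∈ S ∧ b ∈ S ∧ edgeAdj a b
  symm := ⟨fun a b h => ⟨h.2.1, h.1, by
    have := h.2.2
    unfold edgeAdj at *
    rw [abs_sub_comm b.1, abs_sub_comm b.2]
    exact this⟩⟩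
  loopless := ⟨fun a h => by
    have := h.2.2
    simp [edgeAdj] at this⟩

/-- The data of a mission with `N` robots, `M` tasks and at most `m` robots at work in one task. -/
structure Mission (N M m : ℕ) where
  /-- side length of a cell -/
  eps : ℝ
  /-- the tiling -/
  tiling : Finset Cell
  /-- the true nature of the cells, unknown to the robots -/
  kind : Cell → CellKind
  /-- the task to which a cell belongs -/
  task : Cell → Fin M
  /-- the sub-region of its task to which a cell belongs -/
  subOf : Cell → Fin m
  /-- the number of targets hidden in a cell -/
  targets : Cell → ℕ
  /-- expected number of targets of a task -/
  lam : Fin M → ℝ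
  /-- range of the obstacle detector -/
  rs : ℝ
  /-- curvature and inflection point of the battery models -/
  rho0 : Fin N → ℝ
  rho1 : Fin N → ℝ
  /-- traveling speed -/
  u : ℝ
  /-- tasking speed of one robot -/
  omega : ℝ
  /-- a task is close to be finished if its remaining time is at most `eta` -/
  eta : ℝ
  /-- a task has sufficient work left if its remaining time is at least `gamma` -/
  gamma : ℝ
  /-- neighbourhood sizes in no-idling and in resilience games -/
  kappa1 : ℕ
  kappa2 : ℕ
  /-- number of cycles and learning parameter of Max-Logit -/
  cycles : ℕ
  tau : ℝ
  /-- time without heartbeat after which a failure is detected -/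
  T0 : ℕ
  /-- exogenous potential field of the multiscale potential surfaces: level, (coarse) cell -/
  B : ℕ → Cell → ℝ
  /-- initial positions and initial allocation -/
  pos0 : Fin N → Cell
  rc0 : Fin N → Fin M

variable {N M m : ℕ}

/-- A game in progress. -/
structure Game (N M : ℕ) where
  players : Finset (Fin N)
  actions : Finset (Fin M)
  /-- current joint action (relevant on the players) -/
  act : Fin N → Fin M
  /-- number of Max-Logit cycles played -/
  cycle : ℕ
  /-- available worths of the tasks -/
  worth : Fin M → ℝ
  /-- success probabilities -/
  prob : Fin N → Fin M → ℝ
  /-- players that finish their current task before a reallocation takes effect -/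
  finishing : Finset (Fin N)

/-- The configuration of the team at one time. -/
structure State (N M m : ℕ) where
  mode : Fin N → DState
  pos : Fin N → Cell
  /-- current task -/
  rc : Fin N → Fin M
  /-- task to be taken up once the current one is finished -/
  next : Fin N → Option (Fin M)
  /-- sub-region of the current task selected by the robot -/
  sub : Fin N → Option (Fin m)
  /-- current waypoint -/
  wp : Fin N → Option Cell
  /-- the cell explored by the robot in this time step, if any -/
  tasked : Fin N → Option Cell
  /-- total tasking time -/
  tk : Fin N → ℕ
  /-- time elapsed since the failure of the robot -/
  silent : Fin N → ℕ
  /-- failed robots whose failure has been dealt with -/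
  handled : Finset (Fin N)
  /-- the shared symbolic map: explored cells, and cells known to be obstacle or forbidden -/
  explored : Finset Cell
  detected : Finset Cell
  game : Option (Game N M)

namespace Mission

variable (P : Mission N M m)

/-- The allowed cells. -/
def allowed : Finset Cell := P.tiling.filter fun c => P.kind c = .allowed

def center (c : Cell) : Plane := !₂[P.eps * (c.1 + 1 / 2), P.eps * (c.2 + 1 / 2)]

/-- The square occupied by a cell. -/
def square (c : Cell) : Set Plane :=
  {x | P.eps * c.1 ≤ x 0 ∧ x 0 ≤ P.eps * (c.1 + 1) ∧ P.eps * c.2 ≤ x 1 ∧ x 1 ≤ P.eps * (c.2 + 1)}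

/-- The free space. -/
def freeSpace : Set Plane := ⋃ c ∈ P.allowed, P.square c

def centroid (S : Finset Cell) : Plane := (S.card : ℝ)⁻¹ • ∑ c ∈ S, P.center c

def taskCells (r : Fin M) : Finset Cell := P.tiling.filter fun c => P.task c = r

def subCells (r : Fin M) (q : Fin m) : Finset Cell := (P.taskCells r).filter fun c => P.subOf c = q

/-- Standing assumptions on the parameters. -/
structure Valid : Prop where
  eps_pos : 0 < P.eps
  /-- the detector reaches the neighbouring cells -/
  eps_le_rs : P.eps ≤ P.rs
  u_pos : 0 < P.u
  omega_pos : 0 < P.omega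
  eta_pos : 0 < P.eta
  gamma_pos : 0 < P.gamma
  tau_pos : 0 < P.tau
  lam_nonneg : ∀ r, 0 ≤ P.lam r
  kappa1_pos : 0 < P.kappa1
  kappa2_pos : 0 < P.kappa2
  cycles_pos : 0 < P.cycles
  B_pos : ∀ l c, 0 < P.B l c
  /-- the robots start in the free space -/
  pos0_mem : ∀ i, P.pos0 i ∈ P.allowed
  /-- any two allowed cells are joined by a path of allowed cells -/
  connected : ∀ a ∈ P.allowed, ∀ b ∈ P.allowed, (cellGraph P.allowed).Reachable a b

/-! ### The symbolic map -/

variable (s : State N M m)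

/-- The cells not known to be blocked, as a graph. -/
def openGraph : SimpleGraph Cell := cellGraph (P.tiling \ s.detected)

/-- A cell is unexplored if it is neither explored nor known to be blocked nor closed off from the
robots by cells known to be blocked. -/
def Unexplored (c : Cell) : Prop :=
  c ∉ s.explored ∧ c ∉ s.detected ∧ ∃ i, (P.openGraph s).Reachable (s.pos i) c

/-- The number of unexplored cells in a set of cells. -/
def unexploredCount (S : Finset Cell) : ℕ := (S.filter fun c => P.Unexplored s c).card

/-- The number of unexplored cells of a task. -/
def nU (r : Fin M) : ℕ := P.unexploredCount s (P.taskCells r)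

/-! ### Allocation, times, worths and success probabilities -/

/-- The failure of the robot has been detected by the team. -/
def FailureConfirmed (i : Fin N) : Prop := s.mode i = FL ∧ P.T0 ≤ s.silent i

/-- The robot is on duty, as far as the team knows. -/
def OnDuty (i : Fin N) : Prop :=
  s.mode i = WK ∨ s.mode i = NG ∨ s.mode i = RG ∨ (s.mode i = FL ∧ ¬ P.FailureConfirmed s i)

/-- The robots on duty whose current task is `r`. -/
def engaged (r : Fin M) : Finset (Fin N) :=
  Finset.univ.filter fun i => P.OnDuty s i ∧ s.rc i = r

/-- The robots assigned to `r`, now or after their current task. -/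
def assigned (r : Fin M) : Finset (Fin N) :=
  Finset.univ.filter fun i => P.OnDuty s i ∧ (s.rc i = r ∨ s.next i = some r)

/-- The time that the assigned robots need to complete the task. It is `0` for a completed task,
and infinite for an incomplete task that no robot is assigned to. -/
def tc (r : Fin M) : ℝ≥0∞ :=
  (P.nU s r : ℝ≥0∞) / (ENNReal.ofReal P.omega * ((P.assigned s r).card : ℝ≥0∞))

/-- The current task of the robot is completed or close to be finished. -/
def NearDone (i : Fin N) : Prop := P.tc s (s.rc i) ≤ ENNReal.ofReal P.eta

/-- Battery reliability. -/
def reliability (i : Fin N) (t : ℝ) : ℝ := 1 / (1 + Real.exp (P.rho0 i * (t - P.rho1 i)))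

/-- Success probability of a robot for a task. -/
def successProb (i : Fin N) (r : Fin M) : ℝ :=
  P.reliability i (s.tk i + dist (P.center (s.pos i)) (P.centroid (P.taskCells r)) / P.u
    + P.nU s r / P.omega + (if P.NearDone s i then (P.tc s (s.rc i)).toReal else 0))

/-- The number of targets discovered in a task. -/
def discovered (r : Fin M) : ℕ := ∑ c ∈ s.explored.filter (fun c => P.task c = r), P.targets c

/-- The expected number of undiscovered targets of a task. -/
def remainingWorth (r : Fin M) : ℝ :=
  (P.lam r - P.discovered s r) + Real.exp (- P.lam r) *
    ∑ x ∈ Finset.range (P.discovered s r + 1),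
      ((P.discovered s r : ℝ) - x) * (P.lam r ^ x / (x.factorial : ℝ))

/-- The part of the worth that is available to the players. -/
def availableWorth (players : Finset (Fin N)) (r : Fin M) : ℝ :=
  P.remainingWorth s r * ∏ i ∈ P.engaged s r \ players, (1 - P.successProb s i r)

/-! ### Post-game coordination: the sub-regions of a task -/

/-- No other robot is engaged in the task of robot `i`. -/
def Sole (i : Fin N) : Prop := ∀ j ∈ P.engaged s (s.rc i), j = i

/-- The working robots that share the task `r` with others and have no unfinished sub-region. -/
def claimants (r : Fin M) : Finset (Fin N) :=
  Finset.univ.filter fun i => s.mode i = WK ∧ s.rc i = r ∧ ¬ P.Sole s i ∧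
    ∀ q, s.sub i = some q → P.unexploredCount s (P.subCells r q) = 0

/-- The incomplete sub-regions of `r` that no robot holds. -/
def freeSubs (r : Fin M) : Finset (Fin m) :=
  Finset.univ.filter fun q => 0 < P.unexploredCount s (P.subCells r q) ∧
    ∀ j ∈ P.engaged s r, s.sub j ≠ some q

/-- A robot that is alone in its task holds the sub-region in which it is located; it is confined
to it as soon as it has to share the task. Among the robots that look for a sub-region of a task,
one that ranks highest selects a free incomplete one at least distance. The others remain
temporarily inactive until their turn comes or a sub-region becomes available. -/
def ClaimPhase (s s' : State N M m) : Prop :=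
  ∃ sub' : Fin N → Option (Fin m), s' = { s with sub := sub' } ∧
    (∀ i, i ∉ P.claimants s (s.rc i) → sub' i =
      if s.mode i = WK ∧ P.Sole s i ∧ s.pos i ∈ P.taskCells (s.rc i)
        then some (P.subOf (s.pos i)) else s.sub i) ∧
    ∀ r, if (P.claimants s r).Nonempty ∧ (P.freeSubs s r).Nonempty then
        ∃ i ∈ P.claimants s r, (∀ j ∈ P.claimants s r, P.successProb s j r ≤ P.successProb s i r) ∧
          (∃ q ∈ P.freeSubs s r, sub' i = some q ∧ ∀ q2 ∈ P.freeSubs s r,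
            dist (P.center (s.pos i)) (P.centroid (P.subCells r q)) ≤
              dist (P.center (s.pos i)) (P.centroid (P.subCells r q2))) ∧
          ∀ j ∈ P.claimants s r, j ≠ i → sub' j = none
      else ∀ j ∈ P.claimants s r, sub' j = none

/-- The region that robot `i` is to cover: its whole task if it is alone there, and otherwise the
sub-region that it holds. -/
def region (i : Fin N) : Finset Cell :=
  if P.Sole s i then P.taskCells (s.rc i)
  else match s.sub i with
    | some q => P.subCells (s.rc i) q
    | none => ∅

/-! ### The single-robot coverage algorithm `ε*` -/

/-- The unexplored cells in the region of robot `i` that it can hope to reach. -/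
def eligible (i : Fin N) : Finset Cell :=
  (P.region s i).filter fun c =>
    c ∉ s.explored ∧ c ∉ s.detected ∧ (P.openGraph s).Reachable (s.pos i) c

/-- Potential surface of the lowest level: `-1` on blocked cells, `0` on explored ones, and the
exogenous potential on unexplored ones. -/
def potential (c : Cell) : ℝ :=
  if c ∈ s.detected then -1 else if c ∈ s.explored then 0 else P.B 0 c

/-- The coarse cell of level `l` that contains a cell. -/
def coarse (l : ℕ) (c : Cell) : Cell := (c.1 / 2 ^ l, c.2 / 2 ^ l)

/-- Potential surface of a higher level: the fraction of eligible cells of the region in a coarse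
cell, times the exogenous potential. -/
def coarsePotential (i : Fin N) (l : ℕ) (a : Cell) : ℝ :=
  (((P.eligible s i).filter fun c => coarse l c = a).card : ℝ) /
    (((P.region s i).filter fun c => coarse l c = a).card : ℝ) * P.B l a

/-- The coarse cell of the robot at level `l` and the ones around it. -/
def coarseNeighbor (i : Fin N) (l : ℕ) (a : Cell) : Prop :=
  |(coarse l (s.pos i)).1 - a.1| ≤ 1 ∧ |(coarse l (s.pos i)).2 - a.2| ≤ 1

/-- A waypoint that is computed at level `l ≥ 1`: a cell in a coarse cell of highest potential
among the neighbouring ones, this potential being positive. -/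
def CoarseWaypoint (i : Fin N) (l : ℕ) (c : Cell) : Prop :=
  c ∈ P.eligible s i ∧ coarseNeighbor s i l (coarse l c) ∧
    0 < P.coarsePotential s i l (coarse l c) ∧
    ∀ a, coarseNeighbor s i l a → P.coarsePotential s i l a ≤ P.coarsePotential s i l (coarse l c)

/-- The waypoints that the algorithm may return. The previous waypoint is kept as long as it
is eligible; then comes the present cell; then the adjacent cells, the one of highest potential
first; and when there are none (a local extremum), the lowest higher level that shows a positive
potential around the robot is used. -/
def Waypoint (i : Fin N) (c : Cell) : Prop :=
  c ∈ P.eligible s i ∧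
  if ∃ w ∈ P.eligible s i, s.wp i = some w then s.wp i = some c
  else if s.pos i ∈ P.eligible s i then c = s.pos i
  else if ∃ a ∈ P.eligible s i, edgeAdj (s.pos i) a then
    edgeAdj (s.pos i) c ∧
      ∀ a ∈ P.eligible s i, edgeAdj (s.pos i) a → P.potential s a ≤ P.potential s c
  else ∃ l, 1 ≤ l ∧ P.CoarseWaypoint s i l c ∧
    ∀ k, 1 ≤ k → k < l → ∀ a, ¬ P.CoarseWaypoint s i k a

/-- What robot `i` does in one time step: it explores its present cell if this is the waypoint, and
otherwise moves to the next cell on a shortest path, through cells not known to be blocked, to the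
waypoint. Robots that are not working, or have nothing to do, stay put. -/
def Acts (i : Fin N) (wp : Option Cell) (pos : Cell) (tasked : Option Cell) : Prop :=
  if s.mode i = WK ∧ (P.eligible s i).Nonempty then
    ∃ c, P.Waypoint s i c ∧ wp = some c ∧
      if c = s.pos i then pos = s.pos i ∧ tasked = some c
      else tasked = none ∧ (P.openGraph s).Adj (s.pos i) pos ∧
        (P.openGraph s).dist pos c + 1 = (P.openGraph s).dist (s.pos i) c
  else wp = none ∧ pos = s.pos i ∧ tasked = none

/-- The result of sensing from given positions: the obstacle and forbidden cells adjacent to a live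
robot are detected for sure, and further ones only within the range of the detectors. -/
def Senses (mode : Fin N → DState) (pos : Fin N → Cell) (old new : Finset Cell) : Prop :=
  old ⊆ new ∧
  (∀ c ∈ P.tiling, P.kind c ≠ .allowed → (∃ i, mode i ≠ FL ∧ edgeAdj (pos i) c) → c ∈ new) ∧
  ∀ c ∈ new, c ∉ old → c ∈ P.tiling ∧ P.kind c ≠ .allowed ∧
    ∃ i, mode i ≠ FL ∧ dist (P.center (pos i)) (P.center c) ≤ P.rs

/-- One time step of motion, exploration and sensing of all robots. -/
def MovePhase (s s' : State N M m) : Prop :=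
  ∃ (wp' : Fin N → Option Cell) (pos' : Fin N → Cell) (tasked' : Fin N → Option Cell)
    (detected' : Finset Cell),
    (∀ i, P.Acts s i (wp' i) (pos' i) (tasked' i)) ∧
    P.Senses s.mode pos' s.detected detected' ∧
    s' = { s with
      wp := wp'
      pos := pos'
      tasked := tasked'
      tk := fun i => if s.mode i = WK then s.tk i + 1 else s.tk i
      explored := s.explored ∪ P.tiling.filter fun c => ∃ i, tasked' i = some c
      detected := detected' }

/-! ### Failures and supervisor events -/

/-- Any set of robots may fail. -/
def FailPhase (s s' : State N M m) : Prop :=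
  ∃ F : Finset (Fin N), s' = { s with
    mode := fun i => if i ∈ F then fire e7 (s.mode i) else s.mode i
    silent := fun i => if s.mode i = FL then s.silent i + 1 else 0 }

/-- Robot `i` is working and its current task is completed. -/
def TaskDone (i : Fin N) : Prop := s.mode i = WK ∧ P.nU s (s.rc i) = 0

/-- Robots are turned on, turn to the task they have been reallocated to, look for a new task when
the current one is completed, or stop when the whole area is covered. -/
def eventPhase : State N M m := { s with
  mode := fun i =>
    if s.mode i = .ST then fire e0 (s.mode i)
    else if P.TaskDone s i ∧ s.next i = none then fire e2 (s.mode i)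
    else if s.mode i = ID ∧ ∑ r, P.nU s r = 0 then fire e6 (s.mode i)
    else s.mode i
  rc := fun i => if P.TaskDone s i then (s.next i).getD (s.rc i) else s.rc i
  next := fun i => if P.TaskDone s i then none else s.next i
  sub := fun i => if P.TaskDone s i then none else s.sub i }

/-! ### Games -/

/-- `S` consists of `κ` nearest neighbours of `v` within `avail` (of all of them if there are
fewer). -/
def Nearest (κ : ℕ) (v : Fin N) (avail S : Finset (Fin N)) : Prop :=
  S ⊆ avail.erase v ∧ S.card = min κ (avail.erase v).card ∧
    ∀ a ∈ S, ∀ b ∈ avail.erase v, b ∉ S →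
      dist (P.center (s.pos v)) (P.center (s.pos a)) ≤
        dist (P.center (s.pos v)) (P.center (s.pos b))

/-- The game with given players and actions that starts with the joint action `act`. -/
def newGame (players : Finset (Fin N)) (actions : Finset (Fin M)) (act : Fin N → Fin M) :
    Game N M where
  players := players
  actions := actions
  act := act
  cycle := 0
  worth := P.availableWorth s players
  prob := P.successProb s
  finishing := players.filter fun i => P.NearDone s i

/-- A no-idling game triggered by `v` starts. -/
def StartNoIdling (v : Fin N) (s s' : State N M m) : Prop :=
  s.mode v = NG ∧ ∃ S players actions act,
    P.Nearest s P.kappa1 v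
      (Finset.univ.filter fun i => s.mode i = WK ∨ s.mode i = ID ∨ s.mode i = NG) S ∧
    players = insert v (S.filter fun i => P.NearDone s i) ∧
    actions = Finset.univ.filter (fun r => ENNReal.ofReal P.gamma ≤ P.tc s r) ∧
    (actions.Nonempty → ∀ i ∈ players, act i ∈ actions) ∧
    s' = { s with
      mode := fun i => if i ∈ players then fire e5 (s.mode i) else s.mode i
      game := some (P.newGame s players actions act) }

/-- The failure of `f` has been detected and is to be dealt with. -/
def PendingFailure (f : Fin N) : Prop := P.FailureConfirmed s f ∧ f ∉ s.handled

/-- Other robots at work in the task of the failed robot take it over, without a game. -/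
def TakeOver (f : Fin N) (s s' : State N M m) : Prop :=
  P.PendingFailure s f ∧ (P.engaged s (s.rc f)).Nonempty ∧
    s' = { s with handled := insert f s.handled }

/-- A resilience game triggered by the failure of `f` starts. -/
def StartResilience (f : Fin N) (s s' : State N M m) : Prop :=
  P.PendingFailure s f ∧ ¬ (P.engaged s (s.rc f)).Nonempty ∧ ∃ players actions act,
    players.Nonempty ∧
    P.Nearest s P.kappa2 f (Finset.univ.filter fun i => s.mode i = WK ∨ s.mode i = ID) players ∧
    actions = insert (s.rc f)
      ((players.image s.rc).filter fun r => ENNReal.ofReal P.eta < P.tc s r) ∧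
    (∀ i ∈ players, act i ∈ actions ∧ (s.rc i ∈ actions → act i = s.rc i)) ∧
    s' = { s with
      mode := fun i => if i ∈ players then fire e1 (s.mode i) else s.mode i
      handled := insert f s.handled
      game := some (P.newGame s players actions act) }

/-- Utility (marginal contribution) of player `i` under the joint action `a`. -/
def utility (g : Game N M) (i : Fin N) (a : Fin N → Fin M) : ℝ :=
  g.worth (a i) * g.prob i (a i) *
    ∏ j ∈ g.players.filter (fun j => j ≠ i ∧ a j = a i), (1 - g.prob j (a i))

/-- One Max-Logit cycle: one live player `i` is selected, considers an action `b`, and switches to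
it with probability `μ`. All outcomes of positive probability are possible. -/
def Cycle (g g' : Game N M) : Prop :=
  ∃ i ∈ g.players, s.mode i ≠ FL ∧ ∃ b ∈ g.actions,
    let ψ : (Fin N → Fin M) → ℝ := fun a => Real.exp (utility g i a / P.tau)
    let a2 := Function.update g.act i b
    let μ := ψ a2 / max (ψ g.act) (ψ a2)
    (0 < μ ∧ g' = { g with act := a2, cycle := g.cycle + 1 }) ∨
    (0 < 1 - μ ∧ g' = { g with cycle := g.cycle + 1 })

/-- All cycles have been played, or there is nothing to decide, or nobody left to do it. -/
def Finished (g : Game N M) : Prop :=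
  P.cycles ≤ g.cycle ∨ g.actions = ∅ ∨ ∀ i ∈ g.players, s.mode i = FL

/-- Player `i` finishes its current task before it moves. -/
def Defers (g : Game N M) (i : Fin N) : Prop :=
  i ∈ g.finishing ∧ 0 < P.nU s (s.rc i) ∧ g.act i ≠ s.rc i

/-- The outcome of a game. If no task is contested, a player becomes idle unless it still has work
from before. Otherwise every live player is assigned its action. -/
def endGame (g : Game N M) : State N M m := { s with
  mode := fun i =>
    if i ∈ g.players ∧ s.mode i ≠ FL then
      if g.actions = ∅ ∧ P.nU s (s.rc i) = 0 ∧ s.next i = none then fire e4 (s.mode i)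
      else fire e3 (s.mode i)
    else s.mode i
  rc := fun i =>
    if i ∈ g.players ∧ s.mode i ≠ FL ∧ g.actions.Nonempty ∧ ¬ P.Defers s g i then g.act i
    else s.rc i
  next := fun i =>
    if i ∈ g.players ∧ s.mode i ≠ FL ∧ g.actions.Nonempty then
      if P.Defers s g i then some (g.act i) else none
    else s.next i
  sub := fun i =>
    if i ∈ g.players ∧ s.mode i ≠ FL ∧ g.actions.Nonempty ∧ ¬ P.Defers s g i ∧ g.act i ≠ s.rc i
    then none else s.sub i
  game := none }

/-- Start of a game, or take-over of the task of a failed robot. -/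
def Trigger (s s' : State N M m) : Prop :=
  (∃ v, P.StartNoIdling v s s') ∨ (∃ f, P.StartResilience f s s') ∨ ∃ f, P.TakeOver f s s'

/-- The optimizer: when no game is in progress, one of the pending triggers, if any, is dealt with;
a game in progress is continued by one cycle, or ended. -/
def GamePhase (s s' : State N M m) : Prop :=
  match s.game with
  | none => P.Trigger s s' ∨ ((¬ ∃ s2, P.Trigger s s2) ∧ s' = s)
  | some g =>
    (P.Finished s g ∧ s' = P.endGame s g) ∨
    (¬ P.Finished s g ∧ ∃ g2, P.Cycle s g g2 ∧ s' = { s with game := some g2 })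

/-! ### Runs -/

/-- One time step of the team under the CARE algorithm. -/
def Step (s s' : State N M m) : Prop :=
  ∃ s1 s2 s3, FailPhase s s1 ∧ P.ClaimPhase s1 s2 ∧ P.MovePhase s2 s3 ∧
    P.GamePhase (P.eventPhase s3) s'

/-- The initial configurations: nothing is known but what the detectors show at the start. -/
def Initial (s : State N M m) : Prop :=
  (∀ i, s.mode i = .ST) ∧ s.pos = P.pos0 ∧ s.rc = P.rc0 ∧ (∀ i, s.next i = none) ∧
  (∀ i, s.sub i = none) ∧ (∀ i, s.wp i = none) ∧ (∀ i, s.tasked i = none) ∧ (∀ i, s.tk i = 0) ∧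
  (∀ i, s.silent i = 0) ∧ s.handled = ∅ ∧ s.explored = ∅ ∧
  P.Senses s.mode s.pos ∅ s.detected ∧ s.game = none

/-- An infinite run of the CARE algorithm. -/
def IsRun (σ : ℕ → State N M m) : Prop := P.Initial (σ 0) ∧ ∀ k, P.Step (σ k) (σ (k + 1))

/-- The cells explored by the robots up to time `K` jointly cover the free space. -/
def CoversBy (σ : ℕ → State N M m) (K : ℕ) : Prop :=
  P.freeSpace ⊆ ⋃ ℓ : Fin N, ⋃ k ∈ Finset.range (K + 1), ⋃ c ∈ (σ k).tasked ℓ, P.square c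

end Mission

end

end CARE

namespace CARE

noncomputable section

open scoped Classical ENNReal
open DState DEvent

namespace Mission

/-! ### Non-blocking: every phase of a step has an outcome. -/

section

variable {N M m : ℕ} (P : Mission N M m) (s : State N M m)

/-! No phase of a step can block: each asks for an extremum over a finite set, for an admissible
reading of the detectors, or for an outcome of positive probability. The point with content is that
the multiscale search always finds a waypoint (`exists_coarseWaypoint`).

Termination rests on two invariants, collected in `Inv`. By `MapInv` the map is correct and robots
stand on allowed cells whose blocked neighbours are known. Since the allowed cells are connected,
all robots then lie in one component of the graph of cells not known to be blocked, so being
unexplored does not depend on the robot and `nU` never increases. The heart of `TeamInv` is `alert`: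
while a task is incomplete, some robot is about to start, is on duty, or has failed without its
failure having been dealt with.

The convergence argument is purely qualitative: a growing family of subsets of a finite set is
eventually constant. Applied to the failed and stopped robots, the failures dealt with, and the
explored and detected cells, this gives the regime `Steady`. There a cascade follows, in which each
set is monotone because the previous one has stabilised: robots whose current task is incomplete,
robots with nothing scheduled, `Jobless` robots, robots that are not `Waiting`. Once all are
constant, no game starts and no task is completed any more (`Static`, reached by
`IsRun.eventually_static`).

If a task were still incomplete in this regime, `alert` and the robot that never fails would yield a
working robot (`Static.exists_working`). Then some working robot has a fixed region with unexplored
cells; it keeps its waypoint and approaches it strictly at each step, so it must eventually explore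
it, although the explored set is constant (`not_static_of_working`). Hence every `nU` vanishes,
which forces live robots into `SP` and, through `MapInv`, means that every allowed cell has been
explored. -/

theorem exists_subset_card_le_of_not_mem {α : Type*} (T : Finset α) (f : α → ℝ) :
    ∀ k ≤ T.card, ∃ S ⊆ T, S.card = k ∧ ∀ a ∈ S, ∀ b ∈ T, b ∉ S → f a ≤ f b := by
  intro k
  induction k with
  | zero => exact fun _ => ⟨∅, by simp, by simp, by simp⟩
  | succ k ih =>
    intro hk
    obtain ⟨S, hS, hc, hf⟩ := ih (by omega)
    have hne : (T \ S).Nonempty := by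
      rw [← Finset.card_pos, Finset.card_sdiff_of_subset hS]; omega
    obtain ⟨x, hx, hmin⟩ := Finset.exists_min_image _ f hne
    rw [Finset.mem_sdiff] at hx
    refine ⟨insert x S, Finset.insert_subset hx.1 hS, by rw [Finset.card_insert_of_notMem hx.2, hc], ?_⟩
    intro a ha b hb hbS
    rw [Finset.mem_insert, not_or] at hbS
    rcases Finset.mem_insert.1 ha with rfl | ha
    · exact hmin b (Finset.mem_sdiff.2 ⟨hb, hbS.2⟩)
    · exact hf a ha b hb hbS.2

theorem exists_nearest (κ : ℕ) (v : Fin N) (avail : Finset (Fin N)) :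
    ∃ S, P.Nearest s κ v avail S := by
  obtain ⟨S, h1, h2, h3⟩ := exists_subset_card_le_of_not_mem (avail.erase v)
    (fun a => dist (P.center (s.pos v)) (P.center (s.pos a))) (min κ (avail.erase v).card)
    (min_le_right _ _)
  exact ⟨S, h1, h2, h3⟩

theorem exists_failPhase : ∃ s', FailPhase s s' := ⟨_, ∅, rfl⟩

/-- The claims can be settled task by task: a claimant of `r` has `r` as its current task, so the
choices made for different tasks never concern the same robot. -/
theorem exists_claimPhase : ∃ s', P.ClaimPhase s s' := by
  have h : ∀ r, ∃ f : Fin N → Option (Fin m),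
      if (P.claimants s r).Nonempty ∧ (P.freeSubs s r).Nonempty then
        ∃ i ∈ P.claimants s r, (∀ j ∈ P.claimants s r, P.successProb s j r ≤ P.successProb s i r) ∧
          (∃ q ∈ P.freeSubs s r, f i = some q ∧ ∀ q2 ∈ P.freeSubs s r,
            dist (P.center (s.pos i)) (P.centroid (P.subCells r q)) ≤
              dist (P.center (s.pos i)) (P.centroid (P.subCells r q2))) ∧
          ∀ j ∈ P.claimants s r, j ≠ i → f j = none
      else ∀ j ∈ P.claimants s r, f j = none := by
    intro r
    split_ifs with hr
    · obtain ⟨i, hi, hmax⟩ := Finset.exists_max_image _ (fun j => P.successProb s j r) hr.1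
      obtain ⟨q, hq, hmin⟩ := Finset.exists_min_image _
        (fun q => dist (P.center (s.pos i)) (P.centroid (P.subCells r q))) hr.2
      exact ⟨fun j => if j = i then some q else none, i, hi, hmax, ⟨q, hq, if_pos rfl, hmin⟩,
        fun j _ hj => if_neg hj⟩
    · exact ⟨fun _ => none, fun _ _ => rfl⟩
  choose f hf using h
  have hrc : ∀ r, ∀ j ∈ P.claimants s r, s.rc j = r := fun r j hj => (Finset.mem_filter.1 hj).2.2.1
  refine ⟨_, fun i => if i ∉ P.claimants s (s.rc i) then
    (if s.mode i = WK ∧ P.Sole s i ∧ s.pos i ∈ P.taskCells (s.rc i)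
        then some (P.subOf (s.pos i)) else s.sub i) else f (s.rc i) i, rfl,
        fun i hi => if_pos hi, fun r => ?_⟩
  have key : ∀ j ∈ P.claimants s r, (if j ∉ P.claimants s (s.rc j) then
    (if s.mode j = WK ∧ P.Sole s j ∧ s.pos j ∈ P.taskCells (s.rc j)
        then some (P.subOf (s.pos j)) else s.sub j) else f (s.rc j) j) = f r j := by
    intro j hj
    rw [hrc r j hj, if_neg (not_not.2 hj)]
  have hr := hf r
  split_ifs at hr ⊢ with hc
  · obtain ⟨i, hi, hmax, ⟨q, hq, h1, h2⟩, h3⟩ := hr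
    exact ⟨i, hi, hmax, ⟨q, hq, (key i hi).trans h1, h2⟩, fun j hj hji => (key j hj).trans (h3 j hj hji)⟩
  · exact fun j hj => (key j hj).trans (hr j hj)

/-- Integer division rounds down, so both quotients are `-1` or `0`. Consequently any two cells have
neighbouring coarse cells at a sufficiently high level. -/
theorem abs_div_two_pow_sub_le_one (x y : ℤ) (l : ℕ) (hx : |x| < 2 ^ l) (hy : |y| < 2 ^ l) :
    |x / 2 ^ l - y / 2 ^ l| ≤ 1 := by
  have hpos : (0 : ℤ) < 2 ^ l := by positivity
  have key : ∀ z : ℤ, |z| < 2 ^ l → -1 ≤ z / 2 ^ l ∧ z / 2 ^ l ≤ 0 := by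
    intro z hz
    rw [abs_lt] at hz
    constructor
    · rw [Int.le_ediv_iff_mul_le hpos]; linarith
    · rw [← Int.lt_add_one_iff, Int.ediv_lt_iff_lt_mul hpos]; linarith
  have := key x hx
  have := key y hy
  rw [abs_le]; omega

theorem exists_coarseNeighbor (i : Fin N) (c : Cell) :
    ∃ l, 1 ≤ l ∧ coarseNeighbor s i l (coarse l c) := by
  obtain ⟨l, hl⟩ := pow_unbounded_of_one_lt
    (|(s.pos i).1| + |(s.pos i).2| + |c.1| + |c.2|) (one_lt_two : (1 : ℤ) < 2)
  have h2 : (2 : ℤ) ^ l ≤ 2 ^ (l + 1) := pow_le_pow_right₀ (by norm_num) (by omega)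
  have := abs_nonneg (s.pos i).1
  have := abs_nonneg (s.pos i).2
  have := abs_nonneg c.1
  have := abs_nonneg c.2
  exact ⟨l + 1, by omega, abs_div_two_pow_sub_le_one _ _ _ (by linarith) (by linarith),
    abs_div_two_pow_sub_le_one _ _ _ (by linarith) (by linarith)⟩

variable {P}

theorem coarsePotential_pos (hP : P.Valid) {i : Fin N} {c : Cell} (hc : c ∈ P.eligible s i) (l : ℕ) :
    0 < P.coarsePotential s i l (coarse l c) := by
  have h1 : 0 < ((P.eligible s i).filter fun b => coarse l b = coarse l c).card :=
    Finset.card_pos.2 ⟨c, by simp [hc]⟩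
  have h2 : 0 < ((P.region s i).filter fun b => coarse l b = coarse l c).card :=
    Finset.card_pos.2 ⟨c, by simp [(Finset.mem_filter.1 hc).1]⟩
  have h3 := hP.B_pos l (coarse l c)
  unfold coarsePotential
  positivity

theorem exists_eligible_of_coarsePotential_pos {i : Fin N} {l : ℕ} {a : Cell}
    (h : 0 < P.coarsePotential s i l a) : ∃ c ∈ P.eligible s i, coarse l c = a := by
  by_contra! hc
  have : (P.eligible s i).filter (fun c => coarse l c = a) = ∅ := by
    rw [Finset.filter_eq_empty_iff]; exact fun c h => hc c h
  simp [coarsePotential, this] at h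

/-- At a level where an eligible cell falls into the `3 × 3` block of coarse cells around the robot,
the maximum of the potential over this block is positive, and a coarse cell of positive potential
contains an eligible cell. -/
theorem exists_coarseWaypoint (hP : P.Valid) {i : Fin N} (h : (P.eligible s i).Nonempty) :
    ∃ l, 1 ≤ l ∧ ∃ c, P.CoarseWaypoint s i l c := by
  obtain ⟨c, hc⟩ := h
  obtain ⟨l, hl, hn⟩ := exists_coarseNeighbor s i c
  refine ⟨l, hl, ?_⟩
  set b := coarse l (s.pos i) with hb
  let T : Finset Cell := Finset.Icc (b.1 - 1) (b.1 + 1) ×ˢ Finset.Icc (b.2 - 1) (b.2 + 1)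
  have hT : ∀ a, a ∈ T ↔ coarseNeighbor s i l a := by
    intro a
    simp only [T, Finset.mem_product, Finset.mem_Icc, coarseNeighbor, abs_le, ← hb]
    omega
  obtain ⟨a, ha, hmax⟩ := Finset.exists_max_image T (P.coarsePotential s i l) ⟨_, (hT _).2 hn⟩
  have hpos : 0 < P.coarsePotential s i l a :=
    (coarsePotential_pos s hP hc l).trans_le (hmax _ ((hT _).2 hn))
  obtain ⟨d, hd, rfl⟩ := exists_eligible_of_coarsePotential_pos s hpos
  exact ⟨d, hd, (hT _).1 ha, hpos, fun a ha => hmax a ((hT a).2 ha)⟩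

theorem exists_waypoint (hP : P.Valid) {i : Fin N} (h : (P.eligible s i).Nonempty) :
    ∃ c, P.Waypoint s i c := by
  unfold Waypoint
  split_ifs with h1 h2 h3
  · obtain ⟨w, hw, hw2⟩ := h1
    exact ⟨w, hw, hw2⟩
  · exact ⟨_, h2, rfl⟩
  · obtain ⟨a, ha, ha2⟩ := h3
    obtain ⟨c, hc, hmax⟩ := Finset.exists_max_image
      ((P.eligible s i).filter fun a => edgeAdj (s.pos i) a) (P.potential s)
      ⟨a, Finset.mem_filter.2 ⟨ha, ha2⟩⟩
    rw [Finset.mem_filter] at hc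
    exact ⟨c, hc.1, hc.2, fun b hb hb2 => hmax b (Finset.mem_filter.2 ⟨hb, hb2⟩)⟩
  · have hex := exists_coarseWaypoint s hP h
    obtain ⟨hl, c, hc⟩ := Nat.find_spec hex
    exact ⟨c, hc.1, _, hl, hc, fun k hk hk2 a ha => Nat.find_min hex hk2 ⟨hk, a, ha⟩⟩

theorem _root_.SimpleGraph.Reachable.exists_adj_dist_add_one {V : Type*} {G : SimpleGraph V} {a b : V}
    (h : G.Reachable a b) (hne : b ≠ a) : ∃ x, G.Adj a x ∧ G.dist x b + 1 = G.dist a b := by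
  obtain ⟨w, hw⟩ := h.exists_walk_length_eq_dist
  cases w with
  | nil => exact absurd rfl hne
  | @cons _ x _ hadj w =>
    refine ⟨x, hadj, ?_⟩
    rw [SimpleGraph.Walk.length_cons] at hw
    have h1 := SimpleGraph.dist_le w
    have hr : G.Reachable x b := ⟨w⟩
    obtain ⟨w2, hw2⟩ := hr.exists_walk_length_eq_dist
    have h2 := SimpleGraph.dist_le (SimpleGraph.Walk.cons hadj w2)
    rw [SimpleGraph.Walk.length_cons] at h2
    omega

theorem exists_acts (hP : P.Valid) (i : Fin N) : ∃ wp pos tasked, P.Acts s i wp pos tasked := by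
  unfold Acts
  split_ifs with h
  · obtain ⟨c, hc⟩ := exists_waypoint s hP h.2
    by_cases hcp : c = s.pos i
    · exact ⟨some c, s.pos i, some c, c, hc, rfl, by simp [hcp]⟩
    · obtain ⟨x, hx, hd⟩ := (Finset.mem_filter.1 hc.1).2.2.2.exists_adj_dist_add_one hcp
      exact ⟨some c, x, none, c, hc, rfl, by rw [if_neg hcp]; exact ⟨rfl, hx, hd⟩⟩
  · exact ⟨none, s.pos i, none, rfl, rfl, rfl⟩

theorem dist_center_of_edgeAdj (hP : P.Valid) {a b : Cell} (h : edgeAdj a b) :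
    dist (P.center a) (P.center b) = P.eps := by
  have hd : ((a.1 : ℝ) - b.1) ^ 2 + ((a.2 : ℝ) - b.2) ^ 2 = 1 := by
    have : (a.1 - b.1) ^ 2 + (a.2 - b.2) ^ 2 = 1 := by
      unfold edgeAdj at h
      have h1 := abs_nonneg (a.1 - b.1)
      have h2 := abs_nonneg (a.2 - b.2)
      rw [← sq_abs (a.1 - b.1), ← sq_abs (a.2 - b.2)]
      rcases (by omega : (|a.1 - b.1| = 0 ∧ |a.2 - b.2| = 1) ∨ (|a.1 - b.1| = 1 ∧ |a.2 - b.2| = 0))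
        with ⟨h, h'⟩ | ⟨h, h'⟩ <;> rw [h, h'] <;> norm_num
    exact_mod_cast this
  rw [EuclideanSpace.dist_eq, Fin.sum_univ_two, Real.dist_eq, Real.dist_eq, sq_abs, sq_abs]
  simp only [center, PiLp.toLp_apply, Matrix.cons_val_zero, Matrix.cons_val_one]
  rw [show (P.eps * (a.1 + 1 / 2) - P.eps * (b.1 + 1 / 2)) ^ 2 +
    (P.eps * (a.2 + 1 / 2) - P.eps * (b.2 + 1 / 2)) ^ 2 =
    P.eps ^ 2 * (((a.1 : ℝ) - b.1) ^ 2 + ((a.2 : ℝ) - b.2) ^ 2) by ring, hd, mul_one,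
    Real.sqrt_sq hP.eps_pos.le]

/-- Detecting exactly the blocked cells adjacent to live robots is admissible, because adjacent
centers are at distance `eps ≤ rs`. -/
theorem exists_senses (hP : P.Valid) (mode : Fin N → DState) (pos : Fin N → Cell)
    (old : Finset Cell) : ∃ new, P.Senses mode pos old new := by
  refine ⟨old ∪ P.tiling.filter fun c => P.kind c ≠ .allowed ∧ ∃ i, mode i ≠ FL ∧ edgeAdj (pos i) c,
    Finset.subset_union_left, ?_, ?_⟩
  · intro c hc hk h
    exact Finset.mem_union_right _ (Finset.mem_filter.2 ⟨hc, hk, h⟩)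
  · intro c hc hold
    rcases Finset.mem_union.1 hc with h | h
    · exact absurd h hold
    · obtain ⟨h1, h2, i, h3, h4⟩ := Finset.mem_filter.1 h
      exact ⟨h1, h2, i, h3, (dist_center_of_edgeAdj hP h4).trans_le hP.eps_le_rs⟩

theorem exists_movePhase (hP : P.Valid) : ∃ s', P.MovePhase s s' := by
  choose wp pos tasked h using exists_acts s hP
  obtain ⟨d, hd⟩ := exists_senses hP s.mode pos s.detected
  exact ⟨_, wp, pos, tasked, d, h, hd, rfl⟩

theorem exists_gamePhase : ∃ s', P.GamePhase s s' := by
  unfold GamePhase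
  cases s.game with
  | none =>
    by_cases h : ∃ s2, P.Trigger s s2
    · exact ⟨h.choose, Or.inl h.choose_spec⟩
    · exact ⟨s, Or.inr ⟨h, rfl⟩⟩
  | some g =>
    by_cases h : P.Finished s g
    · exact ⟨_, Or.inl ⟨h, rfl⟩⟩
    · have h2 := h
      simp only [Finished, not_or, not_forall] at h2
      obtain ⟨-, ha, i, hi, hfl⟩ := h2
      obtain ⟨b, hb⟩ := Finset.nonempty_iff_ne_empty.2 ha
      -- Switching to `b` is always a possible outcome: its probability is a quotient of
      -- exponentials.
      refine ⟨_, Or.inr ⟨h, _, ⟨i, hi, hfl, b, hb, Or.inl ⟨?_, rfl⟩⟩, rfl⟩⟩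
      positivity

theorem exists_step (hP : P.Valid) : ∃ s', P.Step s s' := by
  obtain ⟨s1, h1⟩ := exists_failPhase s
  obtain ⟨s2, h2⟩ := P.exists_claimPhase s1
  obtain ⟨s3, h3⟩ := exists_movePhase s2 hP
  obtain ⟨s4, h4⟩ := exists_gamePhase (P := P) (P.eventPhase s3)
  exact ⟨s4, s1, s2, s3, h1, h2, h3, h4⟩

theorem exists_initial (hP : P.Valid) : ∃ s, P.Initial s := by
  obtain ⟨d, hd⟩ := exists_senses hP (fun _ => .ST) P.pos0 ∅
  exact ⟨{ mode := fun _ => .ST, pos := P.pos0, rc := P.rc0, next := fun _ => none,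
           sub := fun _ => none, wp := fun _ => none, tasked := fun _ => none, tk := fun _ => 0,
           silent := fun _ => 0, handled := ∅, explored := ∅, detected := d, game := none },
    fun _ => rfl, rfl, rfl, fun _ => rfl, fun _ => rfl, fun _ => rfl, fun _ => rfl, fun _ => rfl,
    fun _ => rfl, rfl, rfl, hd, rfl⟩

end

/-! ### Invariants of all reachable configurations. -/

section

variable {N M m : ℕ} {P : Mission N M m} {s s' : State N M m}

/-! ### The map -/

/-- The map is correct, and the robots are at allowed cells whose blocked neighbours are known. -/
structure MapInv (P : Mission N M m) (s : State N M m) : Prop where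
  detected_mem : ∀ c ∈ s.detected, c ∈ P.tiling ∧ P.kind c ≠ .allowed
  explored_mem : s.explored ⊆ P.tiling
  pos_mem : ∀ i, s.pos i ∈ P.allowed
  sensed : ∀ i, ∀ c ∈ P.tiling, P.kind c ≠ .allowed → edgeAdj (s.pos i) c → c ∈ s.detected

theorem MapInv.allowed_subset (h : P.MapInv s) : P.allowed ⊆ P.tiling \ s.detected := by
  intro c hc
  rw [allowed, Finset.mem_filter] at hc
  exact Finset.mem_sdiff.2 ⟨hc.1, fun hd => (h.detected_mem c hd).2 hc.2⟩

theorem cellGraph_mono {S T : Finset Cell} (h : S ⊆ T) : cellGraph S ≤ cellGraph T :=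
  fun _ _ hab => ⟨h hab.1, h hab.2.1, hab.2.2⟩

theorem MapInv.reachable (hP : P.Valid) (h : P.MapInv s) {a b : Cell} (ha : a ∈ P.allowed)
    (hb : b ∈ P.allowed) : (P.openGraph s).Reachable a b :=
  (hP.connected a ha b hb).mono (cellGraph_mono h.allowed_subset)

theorem MapInv.unexplored_iff (hP : P.Valid) (h : P.MapInv s) (i : Fin N) (c : Cell) :
    P.Unexplored s c ↔ c ∉ s.explored ∧ c ∉ s.detected ∧ (P.openGraph s).Reachable (s.pos i) c := by
  refine and_congr_right fun _ => and_congr_right fun _ => ⟨?_, fun h => ⟨i, h⟩⟩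
  rintro ⟨j, hj⟩
  exact (h.reachable hP (h.pos_mem i) (h.pos_mem j)).trans hj

/-- More detected cells mean fewer edges in the open graph, and moving robots between allowed cells
does not leave their component, so no cell can become unexplored again. -/
theorem MapInv.unexplored_of_le (hP : P.Valid) (h : P.MapInv s) (hpos : ∀ i, s'.pos i ∈ P.allowed)
    (he : s.explored ⊆ s'.explored) (hd : s.detected ⊆ s'.detected) {c : Cell}
    (hc : P.Unexplored s' c) : P.Unexplored s c := by
  obtain ⟨h1, h2, i, h3⟩ := hc
  refine ⟨fun h => h1 (he h), fun h => h2 (hd h), i, ?_⟩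
  exact (h.reachable hP (h.pos_mem i) (hpos i)).trans
    (h3.mono (cellGraph_mono (Finset.sdiff_subset_sdiff le_rfl hd)))

theorem MapInv.nU_le (hP : P.Valid) (h : P.MapInv s) (hpos : ∀ i, s'.pos i ∈ P.allowed)
    (he : s.explored ⊆ s'.explored) (hd : s.detected ⊆ s'.detected) (r : Fin M) :
    P.nU s' r ≤ P.nU s r :=
  Finset.card_le_card (Finset.monotone_filter_right _ fun _ _ => h.unexplored_of_le hP hpos he hd)

theorem MapInv.unexplored_congr (hP : P.Valid) (h : P.MapInv s) (h' : P.MapInv s')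
    (he : s'.explored = s.explored) (hd : s'.detected = s.detected) :
    P.Unexplored s' = P.Unexplored s := by
  funext c
  exact propext ⟨h.unexplored_of_le hP h'.pos_mem he.ge hd.ge,
    h'.unexplored_of_le hP h.pos_mem he.le hd.le⟩

theorem MapInv.unexploredCount_congr (hP : P.Valid) (h : P.MapInv s) (h' : P.MapInv s')
    (he : s'.explored = s.explored) (hd : s'.detected = s.detected) :
    P.unexploredCount s' = P.unexploredCount s := by
  funext S
  simp only [unexploredCount, h.unexplored_congr hP h' he hd]

theorem MapInv.nU_congr (hP : P.Valid) (h : P.MapInv s) (h' : P.MapInv s')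
    (he : s'.explored = s.explored) (hd : s'.detected = s.detected) : P.nU s' = P.nU s := by
  funext r
  exact congrFun (h.unexploredCount_congr hP h' he hd) _

theorem MapInv.of_eq (h : P.MapInv s) (hp : s'.pos = s.pos) (he : s'.explored = s.explored)
    (hd : s'.detected = s.detected) : P.MapInv s' := by
  constructor
  · rw [hd]; exact h.detected_mem
  · rw [he]; exact h.explored_mem
  · rw [hp]; exact h.pos_mem
  · rw [hp, hd]; exact h.sensed

theorem nU_pos_iff {r : Fin M} : P.nU s r ≠ 0 ↔ ∃ c ∈ P.taskCells r, P.Unexplored s c := by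
  rw [nU, unexploredCount, ← Nat.pos_iff_ne_zero, Finset.card_pos]
  simp only [Finset.Nonempty, Finset.mem_filter]

/-- Only the map, the positions and quantities that concern motion have changed, and knowledge has
grown. -/
structure Moved (P : Mission N M m) (s s' : State N M m) : Prop where
  mode : s'.mode = s.mode
  rc : s'.rc = s.rc
  next : s'.next = s.next
  silent : s'.silent = s.silent
  handled : s'.handled = s.handled
  game : s'.game = s.game
  explored : s.explored ⊆ s'.explored
  detected : s.detected ⊆ s'.detected
  mapInv : P.MapInv s'

theorem MapInv.of_initial (hP : P.Valid) (h : P.Initial s) : P.MapInv s := by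
  obtain ⟨hm, hp, -, -, -, -, -, -, -, -, he, hs, -⟩ := h
  refine ⟨fun c hc => ?_, by simp [he], fun i => hp ▸ hP.pos0_mem i, fun i c hc hk ha => ?_⟩
  · have := hs.2.2 c hc (by simp)
    exact ⟨this.1, this.2.1⟩
  · exact hs.2.1 c hc hk ⟨i, by simp [hm], ha⟩

theorem MapInv.of_movePhase (h : P.MapInv s) (hm : P.MovePhase s s') : P.MapInv s' := by
  obtain ⟨wp, pos, tasked, d, ha, hs, rfl⟩ := hm
  -- A robot that stays put has already sensed its neighbours, whatever its mode; a robot that moves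
  -- has not failed, so its detector covers the new position. The move leads to an allowed cell
  -- because blocked neighbours were known beforehand.
  have hpos : ∀ i, pos i = s.pos i ∨
      (s.mode i ≠ FL ∧ (P.openGraph s).Adj (s.pos i) (pos i)) := by
    intro i
    have := ha i
    unfold Acts at this
    split_ifs at this with h1
    · obtain ⟨c, -, -, h2⟩ := this
      split_ifs at h2
      · exact Or.inl h2.1
      · exact Or.inr ⟨by simp [h1.1], h2.2.1⟩
    · exact Or.inl this.2.1
  constructor
  · intro c hc
    by_cases hold : c ∈ s.detected
    · exact h.detected_mem c hold
    · have := hs.2.2 c hc hold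
      exact ⟨this.1, this.2.1⟩
  · exact Finset.union_subset h.explored_mem (Finset.filter_subset _ _)
  · intro i
    rcases hpos i with h1 | ⟨-, -, h2, h3⟩
    · simp only [h1]; exact h.pos_mem i
    · rw [Finset.mem_sdiff] at h2
      refine Finset.mem_filter.2 ⟨h2.1, ?_⟩
      by_contra hk
      exact h2.2 (h.sensed i _ h2.1 hk h3)
  · intro i c hc hk hadj
    rcases hpos i with h1 | ⟨h1, -⟩
    · simp only [h1] at hadj
      exact hs.1 (h.sensed i c hc hk hadj)
    · exact hs.2.1 c hc hk ⟨i, h1, hadj⟩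

theorem Moved.of_phases (h : P.MapInv s) {s2 : State N M m} (hc : P.ClaimPhase s s2)
    (hm : P.MovePhase s2 s') : P.Moved s s' := by
  obtain ⟨sub', rfl, -⟩ := hc
  have hinv := MapInv.of_movePhase (s := { s with sub := sub' }) (h.of_eq rfl rfl rfl) hm
  obtain ⟨wp, pos, tasked, d, -, hs, rfl⟩ := hm
  exact ⟨rfl, rfl, rfl, rfl, rfl, rfl, Finset.subset_union_left, hs.1, hinv⟩

theorem Moved.nU_le (hP : P.Valid) (h : P.Moved s s') (hs : P.MapInv s) (r : Fin M) :
    P.nU s' r ≤ P.nU s r :=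
  hs.nU_le hP h.mapInv.pos_mem h.explored h.detected r

/-- The cases of the game phase. -/
theorem GamePhase.cases (h : P.GamePhase s s') :
    (s.game = none ∧ (P.Trigger s s' ∨ ((¬ ∃ s2, P.Trigger s s2) ∧ s' = s))) ∨
    ∃ g, s.game = some g ∧ ((P.Finished s g ∧ s' = P.endGame s g) ∨
      (¬ P.Finished s g ∧ ∃ g2, P.Cycle s g g2 ∧ s' = { s with game := some g2 })) := by
  unfold GamePhase at h
  cases hg : s.game with
  | none => rw [hg] at h; exact Or.inl ⟨rfl, h⟩
  | some g => rw [hg] at h; exact Or.inr ⟨g, rfl, h⟩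

theorem GamePhase.frame (h : P.GamePhase s s') : s'.pos = s.pos ∧ s'.explored = s.explored ∧
    s'.detected = s.detected ∧ s'.silent = s.silent ∧ s'.tasked = s.tasked ∧ s'.wp = s.wp := by
  rcases h.cases with ⟨-, (⟨v, -, S, p, a, act, -, -, -, -, rfl⟩ |
    ⟨f, -, -, p, a, act, -, -, -, -, rfl⟩ | ⟨f, -, -, rfl⟩) | ⟨-, rfl⟩⟩ |
    ⟨g, -, ⟨-, rfl⟩ | ⟨-, g2, -, rfl⟩⟩ <;>
  exact ⟨rfl, rfl, rfl, rfl, rfl, rfl⟩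

theorem GamePhase.nU_eq (h : P.GamePhase s s') : P.nU s' = P.nU s := by
  obtain ⟨h1, h2, h3, -⟩ := h.frame
  have : P.Unexplored s' = P.Unexplored s := by
    funext c
    simp only [Unexplored, openGraph, h1, h2, h3]
  funext r
  simp only [nU, unexploredCount, this]

theorem GamePhase.mapInv (h : P.GamePhase s s') (hs : P.MapInv s) : P.MapInv s' := by
  obtain ⟨h1, h2, h3, -⟩ := h.frame
  exact hs.of_eq h1 h2 h3

theorem MapInv.of_failPhase (h : P.MapInv s) (hf : FailPhase s s') : P.MapInv s' := by
  obtain ⟨F, rfl⟩ := hf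
  exact h.of_eq rfl rfl rfl

theorem MapInv.step (h : P.MapInv s) (hs : P.Step s s') : P.MapInv s' := by
  obtain ⟨s1, s2, s3, h1, h2, h3, h4⟩ := hs
  exact h4.mapInv ((Moved.of_phases (h.of_failPhase h1) h2 h3).mapInv.of_eq rfl rfl rfl)

/-! ### Invariants of the supervisors -/

/-- The robot is on duty and has not failed. -/
def Active (s : State N M m) (i : Fin N) : Prop := s.mode i = WK ∨ s.mode i = NG ∨ s.mode i = RG

/-- The robot has failed and its failure has not been dealt with. -/
def OpenFailure (s : State N M m) (i : Fin N) : Prop := s.mode i = FL ∧ i ∉ s.handled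

/-- The goal is `alert`; the other fields make it inductive. The delicate event is the end of a game
without actions, which may send players to `ID`: `support` guarantees that for each incomplete task
some robot survives this as a witness. The field `handled` ensures that a fresh failure counts as
open. -/
structure TeamInv (P : Mission N M m) (s : State N M m) : Prop where
  idle : ∀ i, s.mode i = ID → P.nU s (s.rc i) = 0 ∧ s.next i = none
  resil : ∀ i, s.mode i = RG → ∃ g, s.game = some g ∧ i ∈ g.players
  noIdling : ∀ i, s.mode i = NG →
    (∃ g, s.game = some g ∧ i ∈ g.players) ∨ (P.nU s (s.rc i) = 0 ∧ s.next i = none)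
  players : ∀ g, s.game = some g → ∀ i ∈ g.players, s.mode i = NG ∨ s.mode i = RG ∨ s.mode i = FL
  handled : ∀ f ∈ s.handled, P.FailureConfirmed s f
  stopped : ∀ i, s.mode i = SP → ∀ r, P.nU s r = 0
  act_mem : ∀ g, s.game = some g → g.actions.Nonempty → ∀ i ∈ g.players, g.act i ∈ g.actions
  alert : ∀ r, P.nU s r ≠ 0 → ∃ i, s.mode i = .ST ∨ Active s i ∨ OpenFailure s i
  support : ∀ g, s.game = some g → g.actions = ∅ → ∀ r, P.nU s r ≠ 0 → ∃ i,
    (Active s i ∧ (s.rc i = r ∨ s.next i = some r ∨ i ∉ g.players)) ∨ OpenFailure s i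

theorem TeamInv.of_initial (h : P.Initial s) : P.TeamInv s := by
  obtain ⟨hm, -, -, -, -, -, -, -, -, hh, -, -, hg⟩ := h
  constructor <;> try simp [hm, hh, hg]
  intro r hr
  -- An unexplored cell is reachable from some robot, so the team is nonempty.
  obtain ⟨c, -, -, -, i, -⟩ := nU_pos_iff.1 hr
  exact ⟨i⟩

theorem fire_e7 (x : DState) : fire e7 x = FL ∨ x = SP ∧ fire e7 x = SP := by
  cases x <;> simp [fire, delta]

theorem TeamInv.of_failPhase (h : P.TeamInv s) (hf : FailPhase s s') : P.TeamInv s' := by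
  obtain ⟨F, rfl⟩ := hf
  have key : ∀ i, (if i ∈ F then fire e7 (s.mode i) else s.mode i) = s.mode i ∨
      (s.mode i ≠ FL ∧ (if i ∈ F then fire e7 (s.mode i) else s.mode i) = FL) := by
    intro i
    split_ifs
    · cases s.mode i <;> simp [fire, delta]
    · simp
  have back : ∀ i x, x ≠ FL → (if i ∈ F then fire e7 (s.mode i) else s.mode i) = x →
      s.mode i = x := by
    intro i x hx hi
    rcases key i with h1 | ⟨-, h1⟩
    · rw [← h1, hi]
    · exact absurd (hi.symm.trans h1) hx
  have hfl : ∀ i, s.mode i ≠ FL → i ∉ s.handled := fun i hi hh => hi (h.handled i hh).1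
  constructor
  · exact fun i hi => h.idle i (back i _ (by simp) hi)
  · exact fun i hi => h.resil i (back i _ (by simp) hi)
  · exact fun i hi => h.noIdling i (back i _ (by simp) hi)
  · intro g hg i hi
    rcases key i with h1 | ⟨-, h1⟩
    · simpa only [h1] using h.players g hg i hi
    · exact Or.inr (Or.inr h1)
  · intro f hf
    obtain ⟨h1, h2⟩ := h.handled f hf
    rcases key f with h3 | ⟨h3, -⟩
    · refine ⟨h3.trans h1, ?_⟩
      simp only [h1, if_true]
      omega
    · exact absurd h1 h3
  · exact fun i hi => h.stopped i (back i _ (by simp) hi)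
  · exact h.act_mem
  · intro r hr
    obtain ⟨i, hi⟩ := h.alert r hr
    refine ⟨i, ?_⟩
    simp only [Active, OpenFailure] at hi ⊢
    rcases key i with h1 | ⟨h1, h2⟩
    · simpa only [h1] using hi
    · exact Or.inr (Or.inr ⟨h2, hfl i h1⟩)
  · intro g hg ha r hr
    obtain ⟨i, hi⟩ := h.support g hg ha r hr
    refine ⟨i, ?_⟩
    simp only [Active, OpenFailure] at hi ⊢
    rcases key i with h1 | ⟨h1, h2⟩
    · simpa only [h1] using hi
    · exact Or.inr ⟨h2, hfl i h1⟩

theorem TeamInv.of_moved (hP : P.Valid) (h : P.TeamInv s) (hs : P.MapInv s) (hm : P.Moved s s') :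
    P.TeamInv s' := by
  have hn : ∀ r, P.nU s r = 0 → P.nU s' r = 0 := fun r hr => by
    have := hm.nU_le hP hs r; omega
  have hn' : ∀ r, P.nU s' r ≠ 0 → P.nU s r ≠ 0 := fun r hr h0 => hr (hn r h0)
  obtain ⟨h1, h2, h3, h4, h5, h6, -, -, -⟩ := hm
  constructor <;> simp only [h1, h2, h3, h4, h5, h6, Active, OpenFailure, FailureConfirmed]
  · exact fun i hi => ⟨hn _ (h.idle i hi).1, (h.idle i hi).2⟩
  · exact h.resil
  · exact fun i hi => (h.noIdling i hi).imp_right fun h => ⟨hn _ h.1, h.2⟩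
  · exact h.players
  · exact h.handled
  · exact fun i hi r => hn r (h.stopped i hi r)
  · exact h.act_mem
  · exact fun r hr => h.alert r (hn' r hr)
  · exact fun g hg ha r hr => h.support g hg ha r (hn' r hr)

theorem eventPhase_mode_cases (P : Mission N M m) (s : State N M m) (i : Fin N) :
    (s.mode i = .ST ∧ (P.eventPhase s).mode i = WK) ∨
    (P.TaskDone s i ∧ s.next i = none ∧ (P.eventPhase s).mode i = NG) ∨
    (s.mode i = ID ∧ (∀ r, P.nU s r = 0) ∧ (P.eventPhase s).mode i = SP) ∨
    (s.mode i ≠ .ST ∧ ¬ (P.TaskDone s i ∧ s.next i = none) ∧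
      ¬ (s.mode i = ID ∧ ∀ r, P.nU s r = 0) ∧ (P.eventPhase s).mode i = s.mode i) := by
  simp only [eventPhase]
  have : ∑ r, P.nU s r = 0 ↔ ∀ r, P.nU s r = 0 := by simp
  split_ifs with h1 h2 h3
  · exact Or.inl ⟨h1, by simp [h1, fire, delta]⟩
  · exact Or.inr (Or.inl ⟨h2.1, h2.2, by simp [h2.1.1, fire, delta]⟩)
  · exact Or.inr (Or.inr (Or.inl ⟨h3.1, this.1 h3.2, by simp [h3.1, fire, delta]⟩))
  · exact Or.inr (Or.inr (Or.inr ⟨h1, h2, fun h => h3 ⟨h.1, this.2 h.2⟩, rfl⟩))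

theorem eventPhase_rc (P : Mission N M m) (s : State N M m) {i : Fin N} (h : ¬ P.TaskDone s i) :
    (P.eventPhase s).rc i = s.rc i := if_neg h

theorem eventPhase_next (P : Mission N M m) (s : State N M m) {i : Fin N} (h : ¬ P.TaskDone s i) :
    (P.eventPhase s).next i = s.next i := if_neg h

theorem eventPhase_rc_of_done {i : Fin N} (h : P.TaskDone s i) :
    (P.eventPhase s).rc i = (s.next i).getD (s.rc i) := if_pos h

theorem eventPhase_next_of_done {i : Fin N} (h : P.TaskDone s i) :
    (P.eventPhase s).next i = none := if_pos h

theorem eventPhase_active {i : Fin N} (h : Active s i) : Active (P.eventPhase s) i := by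
  rcases P.eventPhase_mode_cases s i with ⟨h1, h2⟩ | ⟨-, -, h2⟩ | ⟨h1, -⟩ | ⟨-, -, -, h2⟩
  · exact Or.inl h2
  · exact Or.inr (Or.inl h2)
  · simp [Active, h1] at h
  · simpa only [Active, h2] using h

theorem eventPhase_mode_FL {i : Fin N} : (P.eventPhase s).mode i = FL ↔ s.mode i = FL := by
  rcases P.eventPhase_mode_cases s i with ⟨h1, h2⟩ | ⟨h1, -, h2⟩ | ⟨h1, -, h2⟩ | ⟨-, -, -, h2⟩
  · simp [h1, h2]
  · simp [h1.1, h2]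
  · simp [h1, h2]
  · rw [h2]

theorem TeamInv.eventPhase (h : P.TeamInv s) : P.TeamInv (P.eventPhase s) := by
  have hnd : ∀ i, s.mode i ≠ WK → ¬ P.TaskDone s i := fun i hi hd => hi hd.1
  have hnU : P.nU (P.eventPhase s) = P.nU s := rfl
  constructor
  · intro i hi
    rcases P.eventPhase_mode_cases s i with ⟨-, h2⟩ | ⟨-, -, h2⟩ | ⟨-, -, h2⟩ | ⟨-, -, -, h2⟩ <;>
      rw [h2] at hi <;> try simp at hi
    have hd := hnd i (by simp [hi])
    rw [eventPhase_rc P s hd, eventPhase_next P s hd, hnU]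
    exact h.idle i hi
  · intro i hi
    rcases P.eventPhase_mode_cases s i with ⟨-, h2⟩ | ⟨-, -, h2⟩ | ⟨-, -, h2⟩ | ⟨-, -, -, h2⟩ <;>
      rw [h2] at hi <;> try simp at hi
    exact h.resil i hi
  · intro i hi
    rcases P.eventPhase_mode_cases s i with ⟨-, h2⟩ | ⟨h1, h3, h2⟩ | ⟨-, -, h2⟩ | ⟨-, -, -, h2⟩ <;>
      rw [h2] at hi <;> try simp at hi
    · right
      rw [eventPhase_rc_of_done h1, eventPhase_next_of_done h1, h3, hnU]
      exact ⟨h1.2, rfl⟩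
    · have hd := hnd i (by simp [hi])
      rw [eventPhase_rc P s hd, eventPhase_next P s hd, hnU]
      exact h.noIdling i hi
  · intro g hg i hi
    have := h.players g hg i hi
    rcases P.eventPhase_mode_cases s i with ⟨h1, h2⟩ | ⟨h1, -, h2⟩ | ⟨h1, -, h2⟩ | ⟨-, -, -, h2⟩
    · simp [h1] at this
    · simp [h1.1] at this
    · simp [h1] at this
    · rwa [h2]
  · intro f hf
    obtain ⟨h1, h2⟩ := h.handled f hf
    exact ⟨eventPhase_mode_FL.2 h1, h2⟩
  · intro i hi
    rcases P.eventPhase_mode_cases s i with ⟨-, h2⟩ | ⟨-, -, h2⟩ | ⟨-, h3, h2⟩ | ⟨-, -, -, h2⟩ <;>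
      rw [h2] at hi <;> try simp at hi
    · exact h3
    · exact h.stopped i hi
  · exact h.act_mem
  · intro r hr
    obtain ⟨i, hi | hi | hi⟩ := h.alert r hr
    · refine ⟨i, Or.inr (Or.inl (Or.inl ?_))⟩
      rcases P.eventPhase_mode_cases s i with ⟨-, h2⟩ | ⟨h1, -, h2⟩ | ⟨h1, -, h2⟩ | ⟨h1, -, -, h2⟩
      · exact h2
      · simp [h1.1] at hi
      · simp [h1] at hi
      · exact absurd hi h1
    · exact ⟨i, Or.inr (Or.inl (eventPhase_active hi))⟩
    · exact ⟨i, Or.inr (Or.inr ⟨eventPhase_mode_FL.2 hi.1, hi.2⟩)⟩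
  · intro g hg ha r hr
    obtain ⟨i, ⟨hi, hi2⟩ | hi⟩ := h.support g hg ha r hr
    · refine ⟨i, Or.inl ⟨eventPhase_active hi, ?_⟩⟩
      by_cases hd : P.TaskDone s i
      · rcases hi2 with rfl | hi2 | hi2
        · exact absurd hd.2 hr
        · left; rw [eventPhase_rc_of_done hd, hi2]; rfl
        · exact Or.inr (Or.inr hi2)
      · rw [eventPhase_rc P s hd, eventPhase_next P s hd]
        exact hi2
    · exact ⟨i, Or.inr ⟨eventPhase_mode_FL.2 hi.1, hi.2⟩⟩

/-- Without assigned robots the denominator of `tc` is `0`, and in `ℝ≥0∞` a nonzero number divided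
by `0` is `⊤`. -/
theorem exists_assigned_of_tc_ne_top {r : Fin M} (hr : P.nU s r ≠ 0) (h : P.tc s r ≠ ⊤) :
    ∃ i, P.OnDuty s i ∧ (s.rc i = r ∨ s.next i = some r) := by
  by_contra! hc
  have : P.assigned s r = ∅ := by
    rw [assigned, Finset.filter_eq_empty_iff]
    rintro i - ⟨h1, h2⟩
    have := hc i h1
    tauto
  apply h
  simp only [tc, this, Finset.card_empty, Nat.cast_zero, mul_zero]
  exact ENNReal.div_zero (by exact_mod_cast hr)

theorem nU_ne_zero_of_tc_pos {r : Fin M} (h : 0 < P.tc s r) : P.nU s r ≠ 0 := by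
  intro h0
  simp [tc, h0] at h

theorem TeamInv.active_or_openFailure (h : P.TeamInv s) {i : Fin N} (hi : P.OnDuty s i) :
    Active s i ∨ OpenFailure s i := by
  rcases hi with h1 | h1 | h1 | ⟨h1, h2⟩
  · exact Or.inl (Or.inl h1)
  · exact Or.inl (Or.inr (Or.inl h1))
  · exact Or.inl (Or.inr (Or.inr h1))
  · exact Or.inr ⟨h1, fun hh => h2 (h.handled i hh)⟩

theorem TeamInv.startNoIdling (h : P.TeamInv s) (hg : s.game = none) {v : Fin N}
    (hs : P.StartNoIdling v s s') : P.TeamInv s' := by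
  obtain ⟨hv, S, players, actions, act, hS, hpl, hact, hne, rfl⟩ := hs
  have hpm : ∀ i ∈ players, s.mode i = WK ∨ s.mode i = ID ∨ s.mode i = NG := by
    intro i hi
    rw [hpl, Finset.mem_insert] at hi
    rcases hi with rfl | hi
    · exact Or.inr (Or.inr hv)
    · have := hS.1 (Finset.mem_filter.1 hi).1
      exact (Finset.mem_filter.1 (Finset.mem_of_mem_erase this)).2
  have hpm' : ∀ i ∈ players, fire e5 (s.mode i) = NG := by
    intro i hi
    rcases hpm i hi with h | h | h <;> simp [h, fire, delta]
  have hmode : ∀ i, (i ∈ players ∧ (if i ∈ players then fire e5 (s.mode i) else s.mode i) = NG) ∨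
      (i ∉ players ∧ (if i ∈ players then fire e5 (s.mode i) else s.mode i) = s.mode i) := by
    intro i
    by_cases hi : i ∈ players
    · exact Or.inl ⟨hi, by rw [if_pos hi, hpm' i hi]⟩
    · exact Or.inr ⟨hi, if_neg hi⟩
  have hFL : ∀ i, s.mode i = FL → (if i ∈ players then fire e5 (s.mode i) else s.mode i) = FL := by
    intro i hi
    rcases hmode i with ⟨h1, -⟩ | ⟨-, h2⟩
    · have := hpm i h1; simp [hi] at this
    · rw [h2, hi]
  constructor
  · intro i hi
    rcases hmode i with ⟨-, h1⟩ | ⟨-, h1⟩ <;> simp only [h1] at hi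
    · cases hi
    · exact h.idle i hi
  · intro i hi
    rcases hmode i with ⟨-, h1⟩ | ⟨-, h1⟩ <;> simp only [h1] at hi
    · cases hi
    · obtain ⟨g, hg', -⟩ := h.resil i hi
      simp [hg] at hg'
  · intro i hi
    rcases hmode i with ⟨h2, h1⟩ | ⟨-, h1⟩ <;> simp only [h1] at hi
    · exact Or.inl ⟨_, rfl, h2⟩
    · rcases h.noIdling i hi with ⟨g, hg', -⟩ | h2
      · simp [hg] at hg'
      · exact Or.inr h2
  · rintro _ ⟨⟩ i hi
    left
    simp only [newGame] at hi
    simp [hi, hpm' i hi]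
  · intro f hf
    obtain ⟨h1, h2⟩ := h.handled f hf
    exact ⟨hFL f h1, h2⟩
  · intro i hi
    rcases hmode i with ⟨-, h1⟩ | ⟨-, h1⟩ <;> simp only [h1] at hi
    · cases hi
    · exact h.stopped i hi
  · rintro _ ⟨⟩ hn i hi
    exact hne hn i hi
  · intro r hr
    refine ⟨v, Or.inr (Or.inl (Or.inr (Or.inl ?_)))⟩
    rcases hmode v with ⟨-, h1⟩ | ⟨-, h1⟩
    · exact h1
    · exact h1.trans hv
  · rintro _ ⟨⟩ ha r hr
    simp only [newGame] at ha ⊢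
    -- A task that nobody is assigned to would pass the threshold `gamma` and be an action. As there
    -- are no actions, every incomplete task has an assigned robot, which gives `support`.
    have htc : P.tc s r ≠ ⊤ := by
      intro htop
      have : r ∈ actions := by rw [hact]; simp [htop]
      simp [ha] at this
    obtain ⟨i, hi, hir⟩ := exists_assigned_of_tc_ne_top (s := s) hr htc
    refine ⟨i, ?_⟩
    rcases h.active_or_openFailure hi with h1 | h1
    · left
      refine ⟨?_, by tauto⟩
      rcases hmode i with ⟨-, h2⟩ | ⟨-, h2⟩
      · exact Or.inr (Or.inl h2)
      · simpa only [Active, h2] using h1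
    · exact Or.inr ⟨hFL i h1.1, h1.2⟩

/-- The failure of `f` stops being open, but any player, now in `RG`, witnesses `alert`. `support`
is vacuous because the task of `f` is always an action. -/
theorem TeamInv.startResilience (h : P.TeamInv s) (hg : s.game = none) {f : Fin N}
    (hs : P.StartResilience f s s') : P.TeamInv s' := by
  obtain ⟨hf, -, players, actions, act, hne, hS, hact, hactm, rfl⟩ := hs
  have hpm : ∀ i ∈ players, s.mode i = WK ∨ s.mode i = ID := by
    intro i hi
    exact (Finset.mem_filter.1 (Finset.mem_of_mem_erase (hS.1 hi))).2
  have hpm' : ∀ i ∈ players, fire e1 (s.mode i) = RG := by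
    intro i hi
    rcases hpm i hi with h | h <;> simp [h, fire, delta]
  have hmode : ∀ i, (i ∈ players ∧ (if i ∈ players then fire e1 (s.mode i) else s.mode i) = RG) ∨
      (i ∉ players ∧ (if i ∈ players then fire e1 (s.mode i) else s.mode i) = s.mode i) := by
    intro i
    by_cases hi : i ∈ players
    · exact Or.inl ⟨hi, by rw [if_pos hi, hpm' i hi]⟩
    · exact Or.inr ⟨hi, if_neg hi⟩
  have hFL : ∀ i, s.mode i = FL → (if i ∈ players then fire e1 (s.mode i) else s.mode i) = FL := by
    intro i hi
    rcases hmode i with ⟨h1, -⟩ | ⟨-, h2⟩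
    · have := hpm i h1; simp [hi] at this
    · rw [h2, hi]
  constructor
  · intro i hi
    rcases hmode i with ⟨-, h1⟩ | ⟨-, h1⟩ <;> simp only [h1] at hi
    · cases hi
    · exact h.idle i hi
  · intro i hi
    rcases hmode i with ⟨h2, h1⟩ | ⟨-, h1⟩ <;> simp only [h1] at hi
    · exact ⟨_, rfl, h2⟩
    · obtain ⟨g, hg', -⟩ := h.resil i hi
      simp [hg] at hg'
  · intro i hi
    rcases hmode i with ⟨h2, h1⟩ | ⟨-, h1⟩ <;> simp only [h1] at hi
    · cases hi
    · rcases h.noIdling i hi with ⟨g, hg', -⟩ | h2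
      · simp [hg] at hg'
      · exact Or.inr h2
  · rintro _ ⟨⟩ i hi
    right; left
    simp only [newGame] at hi
    simp [hi, hpm' i hi]
  · intro j hj
    have : P.FailureConfirmed s j := by
      rcases Finset.mem_insert.1 hj with rfl | hj
      · exact hf.1
      · exact h.handled j hj
    exact ⟨hFL j this.1, this.2⟩
  · intro i hi
    rcases hmode i with ⟨-, h1⟩ | ⟨-, h1⟩ <;> simp only [h1] at hi
    · cases hi
    · exact h.stopped i hi
  · rintro _ ⟨⟩ hn i hi
    exact (hactm i hi).1
  · intro r hr
    obtain ⟨v, hv⟩ := hne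
    refine ⟨v, Or.inr (Or.inl (Or.inr (Or.inr ?_)))⟩
    simp [hv, hpm' v hv]
  · rintro _ ⟨⟩ ha r hr
    simp [newGame, hact] at ha

/-- The engaged robot is the new witness for `alert`: it is on duty, hence differs from `f`, whose
failure is confirmed. It may itself have failed undetected, and then its failure is open. -/
theorem TeamInv.takeOver (h : P.TeamInv s) (hg : s.game = none) {f : Fin N}
    (hs : P.TakeOver f s s') : P.TeamInv s' := by
  obtain ⟨hf, ⟨i, hi⟩, rfl⟩ := hs
  refine ⟨h.idle, h.resil, h.noIdling, h.players, ?_, h.stopped, h.act_mem, ?_, ?_⟩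
  · intro j hj
    rcases Finset.mem_insert.1 hj with rfl | hj
    · exact hf.1
    · exact h.handled j hj
  · intro r hr
    refine ⟨i, Or.inr ?_⟩
    have hi := (Finset.mem_filter.1 hi).2.1
    rcases hi with h1 | h1 | h1 | ⟨h1, h2⟩
    · exact Or.inl (Or.inl h1)
    · exact Or.inl (Or.inr (Or.inl h1))
    · exact Or.inl (Or.inr (Or.inr h1))
    · refine Or.inr ⟨h1, fun hh => h2 ?_⟩
      rcases Finset.mem_insert.1 hh with rfl | hh
      · exact hf.1
      · exact h.handled i hh
  · intro g hg'
    simp [hg] at hg'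

/-- The effect of the end of a game on the supervisor of a robot. -/
theorem endGame_mode_cases (h : P.TeamInv s) {g : Game N M} (hg : s.game = some g) (i : Fin N) :
    (i ∈ g.players ∧ Active s i ∧ g.actions = ∅ ∧ P.nU s (s.rc i) = 0 ∧ s.next i = none ∧
      (P.endGame s g).mode i = ID) ∨
    (i ∈ g.players ∧ Active s i ∧ ¬ (g.actions = ∅ ∧ P.nU s (s.rc i) = 0 ∧ s.next i = none) ∧
      (P.endGame s g).mode i = WK) ∨
    (¬ (i ∈ g.players ∧ s.mode i ≠ FL) ∧ (P.endGame s g).mode i = s.mode i) := by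
  simp only [Mission.endGame]
  split_ifs with h1 h2
  · left
    refine ⟨h1.1, ?_, h2.1, h2.2.1, h2.2.2, ?_⟩ <;>
    rcases h.players g hg i h1.1 with h3 | h3 | h3 <;> simp_all [Active, fire, delta]
  · right; left
    refine ⟨h1.1, ?_, h2, ?_⟩ <;>
    rcases h.players g hg i h1.1 with h3 | h3 | h3 <;> simp_all [Active, fire, delta]
  · exact Or.inr (Or.inr ⟨h1, rfl⟩)

/-- If the game has actions, every live player returns to `WK`. If it has none, only players with a
completed task and nothing scheduled become idle, and `support` provides another witness for
`alert`. -/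
theorem TeamInv.endGame (h : P.TeamInv s) {g : Game N M} (hg : s.game = some g) :
    P.TeamInv (P.endGame s g) := by
  have hc := endGame_mode_cases h hg
  have hrc : ∀ i, ¬ (i ∈ g.players ∧ s.mode i ≠ FL ∧ g.actions.Nonempty) →
      (P.endGame s g).rc i = s.rc i ∧ (P.endGame s g).next i = s.next i := by
    intro i hi
    constructor
    · exact if_neg (by tauto)
    · exact if_neg hi
  have hFL : ∀ i, s.mode i = FL → (P.endGame s g).mode i = FL := by
    intro i hi
    rcases hc i with ⟨-, h1, -⟩ | ⟨-, h1, -⟩ | ⟨-, h1⟩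
    · simp [Active, hi] at h1
    · simp [Active, hi] at h1
    · rw [h1, hi]
  have hnU : P.nU (P.endGame s g) = P.nU s := rfl
  constructor
  · intro i hi
    rw [hnU]
    rcases hc i with ⟨-, -, h1, h2, h3, -⟩ | ⟨-, -, -, h1⟩ | ⟨h1, h2⟩
    · obtain ⟨h4, h5⟩ := hrc i (by simp [h1])
      rw [h4, h5]
      exact ⟨h2, h3⟩
    · simp [hi] at h1
    · obtain ⟨h4, h5⟩ := hrc i (by tauto)
      rw [h4, h5]
      exact h.idle i (h2 ▸ hi)
  · intro i hi
    rcases hc i with ⟨-, -, -, -, -, h1⟩ | ⟨-, -, -, h1⟩ | ⟨h1, h2⟩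
    · simp [hi] at h1
    · simp [hi] at h1
    · rw [h2] at hi
      obtain ⟨g', hg', hm⟩ := h.resil i hi
      rw [hg, Option.some.injEq] at hg'
      subst hg'
      exact absurd ⟨hm, by simp [hi]⟩ h1
  · intro i hi
    rw [hnU]
    rcases hc i with ⟨-, -, -, -, -, h1⟩ | ⟨-, -, -, h1⟩ | ⟨h1, h2⟩
    · simp [hi] at h1
    · simp [hi] at h1
    · rw [h2] at hi
      rcases h.noIdling i hi with ⟨g', hg', hm⟩ | h3
      · rw [hg, Option.some.injEq] at hg'
        subst hg'
        exact absurd ⟨hm, by simp [hi]⟩ h1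
      · obtain ⟨h4, h5⟩ := hrc i (by tauto)
        rw [h4, h5]
        exact Or.inr h3
  · rintro _ ⟨⟩
  · intro f hf
    obtain ⟨h1, h2⟩ := h.handled f hf
    exact ⟨hFL f h1, h2⟩
  · intro i hi
    rcases hc i with ⟨-, -, -, -, -, h1⟩ | ⟨-, -, -, h1⟩ | ⟨h1, h2⟩
    · simp [hi] at h1
    · simp [hi] at h1
    · exact h.stopped i (h2 ▸ hi)
  · rintro _ ⟨⟩
  · intro r hr
    rw [hnU] at hr
    by_cases ha : g.actions = ∅
    · obtain ⟨i, ⟨hi, hi2⟩ | hi⟩ := h.support g hg ha r hr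
      · refine ⟨i, Or.inr (Or.inl ?_)⟩
        rcases hc i with ⟨h1, -, -, h3, h4, -⟩ | ⟨-, -, -, h1⟩ | ⟨h1, h2⟩
        · rcases hi2 with rfl | hi2 | hi2
          · exact absurd h3 hr
          · simp [h4] at hi2
          · exact absurd h1 hi2
        · exact Or.inl h1
        · simpa only [Active, h2] using hi
      · exact ⟨i, Or.inr (Or.inr ⟨hFL i hi.1, hi.2⟩)⟩
    · obtain ⟨i, hi⟩ := h.alert r hr
      refine ⟨i, ?_⟩
      rcases hc i with ⟨-, -, h1, -⟩ | ⟨-, -, -, h1⟩ | ⟨-, h1⟩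
      · exact absurd h1 ha
      · exact Or.inr (Or.inl (Or.inl h1))
      · rw [Active, OpenFailure, h1]; exact hi
  · rintro _ ⟨⟩

theorem Cycle.players {g g' : Game N M} (h : P.Cycle s g g') :
    g'.players = g.players ∧ g'.actions = g.actions ∧ g'.cycle = g.cycle + 1 := by
  obtain ⟨i, -, -, b, -, ⟨-, rfl⟩ | ⟨-, rfl⟩⟩ := h <;> exact ⟨rfl, rfl, rfl⟩

theorem Cycle.act_mem {g g' : Game N M} (h : P.Cycle s g g')
    (hg : ∀ i ∈ g.players, g.act i ∈ g.actions) : ∀ i ∈ g'.players, g'.act i ∈ g'.actions := by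
  obtain ⟨i, -, -, b, hb, ⟨-, rfl⟩ | ⟨-, rfl⟩⟩ := h
  · intro j hj
    by_cases hji : j = i
    · subst hji; simpa using hb
    · simpa [hji] using hg j hj
  · exact hg

theorem TeamInv.cycle (h : P.TeamInv s) {g g' : Game N M} (hg : s.game = some g)
    (hc : P.Cycle s g g') : P.TeamInv { s with game := some g' } := by
  obtain ⟨h1, h2, -⟩ := hc.players
  refine ⟨h.idle, ?_, ?_, ?_, h.handled, h.stopped, ?_, h.alert, ?_⟩
  · intro i hi
    obtain ⟨g', hg', hm⟩ := h.resil i hi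
    rw [hg, Option.some.injEq] at hg'
    subst hg'
    exact ⟨_, rfl, h1 ▸ hm⟩
  · intro i hi
    rcases h.noIdling i hi with ⟨g', hg', hm⟩ | h3
    · rw [hg, Option.some.injEq] at hg'
      subst hg'
      exact Or.inl ⟨_, rfl, h1 ▸ hm⟩
    · exact Or.inr h3
  · rintro _ ⟨⟩ i hi
    exact h.players g hg i (h1 ▸ hi)
  · rintro _ ⟨⟩ hn
    exact hc.act_mem (h.act_mem g hg (h2 ▸ hn))
  · rintro _ ⟨⟩ ha r hr
    rw [h1]
    exact h.support g hg (h2 ▸ ha) r hr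

theorem TeamInv.gamePhase (h : P.TeamInv s) (hs : P.GamePhase s s') :
    P.TeamInv s' := by
  rcases hs.cases with ⟨hg, (⟨v, ht⟩ | ⟨f, ht⟩ | ⟨f, ht⟩) | ⟨-, rfl⟩⟩ |
    ⟨g, hg, ⟨-, rfl⟩ | ⟨-, g2, hc, rfl⟩⟩
  · exact h.startNoIdling hg ht
  · exact h.startResilience hg ht
  · exact h.takeOver hg ht
  · exact h
  · exact h.endGame hg
  · exact h.cycle hg hc

/-- The invariants that hold in every reachable configuration. -/
structure Inv (P : Mission N M m) (s : State N M m) : Prop where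
  map : P.MapInv s
  team : P.TeamInv s

theorem Inv.step (hP : P.Valid) (h : P.Inv s) (hs : P.Step s s') : P.Inv s' := by
  refine ⟨h.map.step hs, ?_⟩
  obtain ⟨s1, s2, s3, h1, h2, h3, h4⟩ := hs
  have hm := h.map.of_failPhase h1
  exact (((h.team.of_failPhase h1).of_moved hP hm (Moved.of_phases hm h2 h3)).eventPhase).gamePhase h4

theorem IsRun.inv (hP : P.Valid) {σ : ℕ → State N M m} (h : P.IsRun σ) (k : ℕ) : P.Inv (σ k) := by
  induction k with
  | zero => exact ⟨.of_initial hP h.1, .of_initial h.1⟩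
  | succ k ih => exact ih.step hP (h.2 k)

end

/-! ### Convergence of every run to a regime without games. -/

section

variable {N M m : ℕ} {P : Mission N M m} {s s' : State N M m}

/-! ### Quantities that are monotone along every run -/

theorem fire_of_terminal (e : DEvent) {x : DState} (h : x = FL ∨ x = SP) : fire e x = x := by
  rcases h with rfl | rfl <;> cases e <;> rfl

theorem fire_ne_ST (e : DEvent) {x : DState} (h : x ≠ .ST) : fire e x ≠ .ST := by
  cases x <;> cases e <;> simp_all [fire, delta]

/-- Modes change only through `fire`, so any property of modes stable under all events persists.
This is used for `FL`, for `SP` and for having left `ST`. -/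
theorem GamePhase.mode_of {p : DState → Prop} (hp : ∀ e x, p x → p (fire e x))
    (h : P.GamePhase s s') {i : Fin N} (hi : p (s.mode i)) : p (s'.mode i) := by
  rcases h.cases with ⟨-, (⟨v, -, S, q, a, act, -, -, -, -, rfl⟩ |
    ⟨f, -, -, q, a, act, -, -, -, -, rfl⟩ | ⟨f, -, -, rfl⟩) | ⟨-, rfl⟩⟩ |
    ⟨g, -, ⟨-, rfl⟩ | ⟨-, g2, -, rfl⟩⟩
  · by_cases hq : i ∈ q <;> simp [hq, hp, hi]
  · by_cases hq : i ∈ q <;> simp [hq, hp, hi]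
  · exact hi
  · exact hi
  · simp only [endGame]
    split_ifs <;> simp [hp, hi]
  · exact hi

theorem eventPhase_mode_of {p : DState → Prop} (hp : ∀ e x, p x → p (fire e x)) {i : Fin N}
    (hi : p (s.mode i)) : p ((P.eventPhase s).mode i) := by
  simp only [eventPhase]
  split_ifs <;> simp [hp, hi]

theorem Step.mode_of {p : DState → Prop} (hp : ∀ e x, p x → p (fire e x))
    (h : P.Step s s') {i : Fin N} (hi : p (s.mode i)) : p (s'.mode i) := by
  obtain ⟨s1, s2, s3, ⟨F, rfl⟩, ⟨sub', rfl, -⟩, ⟨wp, pos, tasked, d, -, -, rfl⟩, h4⟩ := h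
  apply h4.mode_of hp
  apply eventPhase_mode_of hp
  by_cases hF : i ∈ F <;> simp [hF, hp, hi]

theorem Step.mode_FL (h : P.Step s s') {i : Fin N} (hi : s.mode i = FL) : s'.mode i = FL :=
  h.mode_of (p := (· = FL)) (fun e _ hx => (fire_of_terminal e (Or.inl hx)).trans hx) hi

theorem Step.mode_SP (h : P.Step s s') {i : Fin N} (hi : s.mode i = SP) : s'.mode i = SP :=
  h.mode_of (p := (· = SP)) (fun e _ hx => (fire_of_terminal e (Or.inr hx)).trans hx) hi

theorem Step.mode_ne_ST (h : P.Step s s') (i : Fin N) : s'.mode i ≠ .ST := by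
  obtain ⟨s1, s2, s3, -, -, -, h4⟩ := h
  refine h4.mode_of (p := (· ≠ .ST)) (fun e x hx => fire_ne_ST e hx) ?_
  rcases P.eventPhase_mode_cases s3 i with ⟨-, h2⟩ | ⟨-, -, h2⟩ | ⟨-, -, h2⟩ | ⟨h1, -, -, h2⟩
  · simp [h2]
  · simp [h2]
  · simp [h2]
  · rwa [h2]

theorem GamePhase.handled_subset (h : P.GamePhase s s') : s.handled ⊆ s'.handled := by
  rcases h.cases with ⟨-, (⟨v, -, S, q, a, act, -, -, -, -, rfl⟩ |
    ⟨f, -, -, q, a, act, -, -, -, -, rfl⟩ | ⟨f, -, -, rfl⟩) | ⟨-, rfl⟩⟩ |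
    ⟨g, -, ⟨-, rfl⟩ | ⟨-, g2, -, rfl⟩⟩
  · exact subset_rfl
  · exact Finset.subset_insert _ _
  · exact Finset.subset_insert _ _
  all_goals exact subset_rfl

theorem Step.handled_subset (h : P.Step s s') : s.handled ⊆ s'.handled := by
  obtain ⟨s1, s2, s3, ⟨F, rfl⟩, ⟨sub', rfl, -⟩, ⟨wp, pos, tasked, d, -, -, rfl⟩, h4⟩ := h
  exact h4.handled_subset

theorem Step.explored_eq (h : P.Step s s') :
    s'.explored = s.explored ∪ P.tiling.filter fun c => ∃ i, s'.tasked i = some c := by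
  obtain ⟨s1, s2, s3, ⟨F, rfl⟩, ⟨sub', rfl, -⟩, ⟨wp, pos, tasked, d, -, -, rfl⟩, h4⟩ := h
  obtain ⟨-, h1, -, -, h2, -⟩ := h4.frame
  rw [h1, h2]
  rfl

theorem Step.explored_subset (h : P.Step s s') : s.explored ⊆ s'.explored := by
  rw [h.explored_eq]; exact Finset.subset_union_left

theorem Step.detected_subset (h : P.Step s s') : s.detected ⊆ s'.detected := by
  obtain ⟨s1, s2, s3, ⟨F, rfl⟩, ⟨sub', rfl, -⟩, ⟨wp, pos, tasked, d, -, hs, rfl⟩, h4⟩ := h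
  rw [h4.frame.2.2.1]
  exact hs.1

theorem Step.silent_eq (h : P.Step s s') {i : Fin N} (hi : s.mode i = FL) :
    s'.silent i = s.silent i + 1 := by
  obtain ⟨s1, s2, s3, ⟨F, rfl⟩, ⟨sub', rfl, -⟩, ⟨wp, pos, tasked, d, -, -, rfl⟩, h4⟩ := h
  rw [h4.frame.2.2.2.1]
  exact if_pos hi

theorem GamePhase.game_of_some (h : P.GamePhase s s') {g : Game N M} (hg : s.game = some g) :
    s'.game = none ∨ ∃ g2, s'.game = some g2 ∧ g2.cycle = g.cycle + 1 ∧ g.cycle < P.cycles := by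
  rcases h.cases with ⟨hg', -⟩ | ⟨g', hg', ⟨-, rfl⟩ | ⟨hf, g2, hc, rfl⟩⟩
  · simp [hg'] at hg
  · exact Or.inl rfl
  · rw [hg, Option.some.injEq] at hg'
    subst hg'
    simp only [Finished, not_or, not_le] at hf
    exact Or.inr ⟨g2, rfl, hc.players.2.2, hf.1⟩

theorem Step.game_of_some (h : P.Step s s') {g : Game N M} (hg : s.game = some g) :
    s'.game = none ∨ ∃ g2, s'.game = some g2 ∧ g2.cycle = g.cycle + 1 ∧ g.cycle < P.cycles := by
  obtain ⟨s1, s2, s3, ⟨F, rfl⟩, ⟨sub', rfl, -⟩, ⟨wp, pos, tasked, d, -, -, rfl⟩, h4⟩ := h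
  exact h4.game_of_some hg

variable {σ : ℕ → State N M m}

/-- Every game comes to an end. -/
theorem IsRun.exists_game_eq_none (h : P.IsRun σ) (k : ℕ) : ∃ k', k ≤ k' ∧ (σ k').game = none := by
  suffices H : ∀ n k g, (σ k).game = some g → P.cycles - g.cycle ≤ n →
      ∃ k', k ≤ k' ∧ (σ k').game = none by
    cases hg : (σ k).game with
    | none => exact ⟨k, le_rfl, hg⟩
    | some g => exact H _ k g hg le_rfl
  intro n
  induction n with
  | zero =>
    intro k g hg hn
    rcases (h.2 k).game_of_some hg with h1 | ⟨g2, -, -, h1⟩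
    · exact ⟨k + 1, by omega, h1⟩
    · omega
  | succ n ih =>
    intro k g hg hn
    rcases (h.2 k).game_of_some hg with h1 | ⟨g2, h1, h2, h3⟩
    · exact ⟨k + 1, by omega, h1⟩
    · obtain ⟨k', hk, h4⟩ := ih (k + 1) g2 h1 (by omega)
      exact ⟨k', by omega, h4⟩

open Filter

/-- From the time when the bounded cardinality attains its maximum on the monotone range, the sets
can no longer grow. -/
theorem eventually_eq_of_eventually_subset {α : Type*} {f : ℕ → Finset α} {T : Finset α}
    (hT : ∀ k, f k ⊆ T) (hf : ∀ᶠ k in atTop, f k ⊆ f (k + 1)) :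
    ∀ᶠ k in atTop, f (k + 1) = f k := by
  obtain ⟨K, hK⟩ := eventually_atTop.1 hf
  have hmono : ∀ a b, K ≤ a → a ≤ b → f a ⊆ f b := by
    intro a b ha hab
    induction b, hab using Nat.le_induction with
    | base => exact subset_rfl
    | succ b hb ih => exact ih.trans (hK b (ha.trans hb))
  let A : Set ℕ := {c | ∃ k, K ≤ k ∧ (f k).card = c}
  have hmem : sSup A ∈ A := Nat.sSup_mem ⟨_, K, le_rfl, rfl⟩
    ⟨T.card, by rintro _ ⟨k, -, rfl⟩; exact Finset.card_le_card (hT k)⟩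
  have hle : ∀ k, K ≤ k → (f k).card ≤ sSup A := fun k hk => le_csSup
    ⟨T.card, by rintro _ ⟨k, -, rfl⟩; exact Finset.card_le_card (hT k)⟩ ⟨k, hk, rfl⟩
  obtain ⟨k0, hk0, hc⟩ := hmem
  have key : ∀ k, k0 ≤ k → f k0 = f k := fun k hk =>
    Finset.eq_of_subset_of_card_le (hmono _ _ hk0 hk) (hc ▸ hle k (hk0.trans hk))
  exact eventually_atTop.2 ⟨k0, fun k hk => (key _ (by omega)).symm.trans (key k hk)⟩

/-- A property of robots that is eventually never lost is eventually never acquired either. -/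
theorem eventually_imp_of_eventually_imp {p : ℕ → Fin N → Prop}
    (h : ∀ᶠ k in atTop, ∀ i, p k i → p (k + 1) i) : ∀ᶠ k in atTop, ∀ i, p (k + 1) i → p k i := by
  have := eventually_eq_of_eventually_subset (f := fun k => Finset.univ.filter (p k))
    (T := Finset.univ) (fun k => Finset.subset_univ _)
    (h.mono fun k hk i hi => by simp at hi ⊢; exact hk i hi)
  refine this.mono fun k hk i hi => ?_
  have : i ∈ Finset.univ.filter (p (k + 1)) := by simpa using hi
  rw [hk] at this
  simpa using this

/-! ### The steady regime -/

/-- A step in which the map, the set of failed robots and the set of stopped ones do not change,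
and no failure is dealt with. -/
structure Steady (P : Mission N M m) (s s' : State N M m) : Prop where
  step : P.Step s s'
  inv : P.Inv s
  inv' : P.Inv s'
  failed : ∀ i, s'.mode i = FL → s.mode i = FL
  stopped : ∀ i, s'.mode i = SP → s.mode i = SP
  started : ∀ i, s.mode i ≠ .ST
  confirmed : ∀ i, s.mode i = FL → P.FailureConfirmed s i
  handled : s'.handled = s.handled
  explored : s'.explored = s.explored
  detected : s'.detected = s.detected

/-- The silence of a failed robot grows by one at each step and so reaches `T0`; there are finitely
many robots. -/
theorem IsRun.eventually_confirmed (h : P.IsRun σ) :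
    ∀ᶠ k in atTop, ∀ i, (σ k).mode i = FL → P.FailureConfirmed (σ k) i := by
  rw [eventually_all]
  intro i
  by_cases hi : ∃ k, (σ k).mode i = FL
  · obtain ⟨k, hk⟩ := hi
    have key : ∀ j, (σ (k + j)).mode i = FL ∧ j ≤ (σ (k + j)).silent i := by
      intro j
      induction j with
      | zero => exact ⟨hk, Nat.zero_le _⟩
      | succ j ih =>
        refine ⟨(h.2 (k + j)).mode_FL ih.1, ?_⟩
        have := (h.2 (k + j)).silent_eq ih.1
        have := ih.2
        simp only [← add_assoc]
        omega
    filter_upwards [eventually_ge_atTop (k + P.T0)] with j hj hfl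
    obtain ⟨d, rfl⟩ := Nat.exists_eq_add_of_le (show k ≤ j by omega)
    exact ⟨hfl, by have := (key d).2; omega⟩
  · exact .of_forall fun k hk => absurd ⟨k, hk⟩ hi

theorem IsRun.eventually_steady (hP : P.Valid) (h : P.IsRun σ) :
    ∀ᶠ k in atTop, P.Steady (σ k) (σ (k + 1)) := by
  have hinv := h.inv hP
  filter_upwards [h.eventually_confirmed,
    eventually_imp_of_eventually_imp (p := fun k i => (σ k).mode i = FL)
      (.of_forall fun k i hi => (h.2 k).mode_FL hi),
    eventually_imp_of_eventually_imp (p := fun k i => (σ k).mode i = SP)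
      (.of_forall fun k i hi => (h.2 k).mode_SP hi),
    eventually_eq_of_eventually_subset (f := fun k => (σ k).handled) (T := Finset.univ)
      (fun k => Finset.subset_univ _) (.of_forall fun k => (h.2 k).handled_subset),
    eventually_eq_of_eventually_subset (f := fun k => (σ k).explored) (T := P.tiling)
      (fun k => (hinv k).map.explored_mem) (.of_forall fun k => (h.2 k).explored_subset),
    eventually_eq_of_eventually_subset (f := fun k => (σ k).detected) (T := P.tiling)
      (fun k c hc => ((hinv k).map.detected_mem c hc).1)
      (.of_forall fun k => (h.2 k).detected_subset),
    eventually_ge_atTop 1] with k h1 h2 h3 h4 h5 h6 h7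
  refine ⟨h.2 k, hinv k, hinv _, h2, h3, ?_, h1, h4, h5, h6⟩
  obtain ⟨j, rfl⟩ := Nat.exists_eq_add_of_le' h7
  exact (h.2 j).mode_ne_ST

theorem Steady.nU_eq (hP : P.Valid) (h : P.Steady s s') : P.nU s' = P.nU s :=
  h.inv.map.nU_congr hP h.inv'.map h.explored h.detected

/-- The configurations in the course of a steady step, after the claims and after the motion. -/
structure Via (P : Mission N M m) (s s₁ s₂ t s' : State N M m) : Prop where
  fail : FailPhase s s₁
  claim : P.ClaimPhase s₁ s₂
  move : P.MovePhase s₂ t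
  game_phase : P.GamePhase (P.eventPhase t) s'
  mode₁ : s₁.mode = s.mode
  confirmed₁ : ∀ i, s₁.mode i = FL → P.FailureConfirmed s₁ i
  map : P.MapInv t
  team : P.TeamInv t
  nU : P.nU t = P.nU s
  mode : t.mode = s.mode
  rc : t.rc = s.rc
  next : t.next = s.next
  game : t.game = s.game
  handled : t.handled = s.handled
  confirmed : ∀ i, t.mode i = FL → P.FailureConfirmed t i

theorem Steady.exists_via (hP : P.Valid) (h : P.Steady s s') : ∃ s₁ s₂ t, P.Via s s₁ s₂ t s' := by
  obtain ⟨s1, s2, t, h1, h2, h3, h4⟩ := h.step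
  have hm := h.inv.map.of_failPhase h1
  have hmv := Moved.of_phases hm h2 h3
  have hteam := (h.inv.team.of_failPhase h1).of_moved hP hm hmv
  have hmode : s1.mode = s.mode := by
    have h1' := h1
    obtain ⟨F, rfl⟩ := h1'
    funext i
    simp only
    split_ifs with hF
    · by_contra hne
      rcases fire_e7 (s.mode i) with h5 | ⟨h5, h6⟩
      · have hfl : fire e7 (s.mode i) = FL := h5
        have hfl2 : s'.mode i = FL := by
          refine h4.mode_of (p := (· = FL))
            (fun e x hx => (fire_of_terminal e (Or.inl hx)).trans hx) ?_
          rw [eventPhase_mode_FL, hmv.mode]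
          simp [hF, hfl]
        rw [h5, h.failed i hfl2] at hne
        exact hne rfl
      · exact hne (h6.trans h5.symm)
    · rfl
  have hc1 : ∀ i, s1.mode i = FL → P.FailureConfirmed s1 i := by
    intro i hi
    refine ⟨hi, ?_⟩
    have hi' : s.mode i = FL := by rw [← hmode, hi]
    have := (h.confirmed i hi').2
    obtain ⟨F, rfl⟩ := h1
    simp only [hi', if_true]
    omega
  have hnU : P.nU t = P.nU s := by
    have h5 : P.nU s' = P.nU t := h4.nU_eq
    rw [← h5, h.nU_eq hP]
  have hs1 : s1.rc = s.rc ∧ s1.next = s.next ∧ s1.game = s.game ∧ s1.handled = s.handled := by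
    obtain ⟨F, rfl⟩ := h1
    exact ⟨rfl, rfl, rfl, rfl⟩
  refine ⟨s1, s2, t, h1, h2, h3, h4, hmode, hc1, hmv.mapInv, hteam, hnU, hmv.mode.trans hmode,
    hmv.rc.trans hs1.1, hmv.next.trans hs1.2.1, hmv.game.trans hs1.2.2.1,
    hmv.handled.trans hs1.2.2.2, ?_⟩
  intro i hi
  rw [hmv.mode] at hi
  have := hc1 i hi
  exact ⟨hmv.mode ▸ hi, hmv.silent ▸ this.2⟩

/-- The cases of the game phase of a steady step. -/
theorem Steady.game_cases {s₁ s₂ t : State N M m} (h : P.Steady s s') (hv : P.Via s s₁ s₂ t s') :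
    (s.game = none ∧ ∃ v, P.StartNoIdling v (P.eventPhase t) s') ∨
    (s.game = none ∧ (¬ ∃ s₃, P.Trigger (P.eventPhase t) s₃) ∧ s' = P.eventPhase t) ∨
    ∃ g, s.game = some g ∧ (s' = P.endGame (P.eventPhase t) g ∨
      ∃ g2, P.Cycle (P.eventPhase t) g g2 ∧ s' = { P.eventPhase t with game := some g2 }) := by
  have hh : s'.handled = (P.eventPhase t).handled := h.handled.trans hv.handled.symm
  rcases hv.game_phase.cases with ⟨hg, (ht | ⟨f, ht⟩ | ⟨f, ht⟩) | ⟨hn, ht⟩⟩ |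
    ⟨g, hg, ⟨-, ht⟩ | ⟨-, ht⟩⟩
  · exact Or.inl ⟨hv.game ▸ hg, ht⟩
  -- Resilience games and take-overs enlarge `handled`, which is constant in a steady step.
  · obtain ⟨hf, _, _, _, _, _, _, _, _, rfl⟩ := ht
    exact absurd (hh ▸ Finset.mem_insert_self _ _) hf.2
  · obtain ⟨hf, -, rfl⟩ := ht
    exact absurd (hh ▸ Finset.mem_insert_self _ _) hf.2
  · exact Or.inr (Or.inl ⟨hv.game ▸ hg, hn, ht⟩)
  · exact Or.inr (Or.inr ⟨g, hv.game ▸ hg, Or.inl ht⟩)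
  · exact Or.inr (Or.inr ⟨g, hv.game ▸ hg, Or.inr ht⟩)

/-- A robot without work: not working, its task completed and no other one scheduled. -/
def Jobless (P : Mission N M m) (s : State N M m) (i : Fin N) : Prop :=
  s.mode i ≠ WK ∧ P.nU s (s.rc i) = 0 ∧ s.next i = none

/-- A robot that is to trigger a no-idling game. -/
def Waiting (s : State N M m) (i : Fin N) : Prop :=
  s.mode i = NG ∧ ∀ g, s.game = some g → i ∉ g.players

/-- The game in progress, if any, is a no-idling game over incomplete tasks. -/
def Contest (P : Mission N M m) (s : State N M m) : Prop :=
  ∀ g, s.game = some g → (∃ v ∈ g.players, s.mode v = NG ∧ P.nU s (s.rc v) = 0 ∧ s.next v = none) ∧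
    ∀ r ∈ g.actions, P.nU s r ≠ 0

theorem eventPhase_of_mode_NG {t : State N M m} {v : Fin N} (h : t.mode v = NG) :
    (P.eventPhase t).mode v = NG ∧ (P.eventPhase t).rc v = t.rc v ∧
      (P.eventPhase t).next v = t.next v := by
  have hd : ¬ P.TaskDone t v := fun hd => by simp [hd.1] at h
  refine ⟨?_, eventPhase_rc P t hd, eventPhase_next P t hd⟩
  rcases P.eventPhase_mode_cases t v with ⟨h1, -⟩ | ⟨h1, -, h2⟩ | ⟨h1, -⟩ | ⟨-, -, -, h2⟩
  · simp [h] at h1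
  · exact h2
  · simp [h] at h1
  · rw [h2, h]

theorem StartNoIdling.mode_players {v : Fin N} {players : Finset (Fin N)} {S : Finset (Fin N)}
    (hv : s.mode v = NG)
    (hS : P.Nearest s P.kappa1 v
      (Finset.univ.filter fun i => s.mode i = WK ∨ s.mode i = ID ∨ s.mode i = NG) S)
    (hp : players = insert v (S.filter fun i => P.NearDone s i)) {i : Fin N} (hi : i ∈ players) :
    fire e5 (s.mode i) = NG := by
  rw [hp, Finset.mem_insert] at hi
  have : s.mode i = WK ∨ s.mode i = ID ∨ s.mode i = NG := by
    rcases hi with rfl | hi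
    · exact Or.inr (Or.inr hv)
    · have := hS.1 (Finset.mem_filter.1 hi).1
      exact (Finset.mem_filter.1 (Finset.mem_of_mem_erase this)).2
  rcases this with h | h | h <;> simp [h, fire, delta]

/-- Only no-idling games can start. Their trigger belongs to no earlier game, so `noIdling` says
that it has no work; their actions have `tc ≥ gamma > 0` and are incomplete. -/
theorem Steady.contest (hP : P.Valid) (h : P.Steady s s') (hc : P.Contest s) : P.Contest s' := by
  obtain ⟨s1, s2, t, hv⟩ := h.exists_via hP
  have hn : P.nU s' = P.nU s := h.nU_eq hP
  have hne : P.nU (P.eventPhase t) = P.nU s := hv.nU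
  intro g hg
  rw [hn]
  rcases h.game_cases hv with ⟨hs, v, h1⟩ | ⟨hs, -, h1⟩ | ⟨g1, hs, h1 | ⟨g2, hcy, h1⟩⟩
  · obtain ⟨hm, S, q, a, act, hS, hpl, hact, -, rfl⟩ := h1
    simp only [Option.some.injEq] at hg
    subst hg
    have hvq : v ∈ q := by rw [hpl]; exact Finset.mem_insert_self _ _
    constructor
    · refine ⟨v, hvq, ?_, ?_⟩
      · simp only [if_pos hvq]
        exact StartNoIdling.mode_players hm hS hpl hvq
      · rcases hv.team.eventPhase.noIdling v hm with ⟨g, hg, -⟩ | h2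
        · have : (P.eventPhase t).game = none := hv.game.trans hs
          simp [this] at hg
        · rw [hne] at h2; exact h2
    · intro r hr
      rw [← hne]
      apply nU_ne_zero_of_tc_pos
      have hr : r ∈ a := hr
      rw [hact, Finset.mem_filter] at hr
      exact (ENNReal.ofReal_pos.2 hP.gamma_pos).trans_le hr.2
  · have : (P.eventPhase t).game = none := hv.game.trans hs
    rw [h1, this] at hg
    cases hg
  · rw [h1] at hg
    cases hg
  · rw [h1, Option.some.injEq] at hg
    subst hg
    obtain ⟨h2, h3, -⟩ := hcy.players
    obtain ⟨⟨v, hvp, hvm, hv1, hv2⟩, ha⟩ := hc g1 hs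
    rw [h2, h3]
    refine ⟨⟨v, hvp, ?_⟩, ha⟩
    obtain ⟨h4, h5, h6⟩ := eventPhase_of_mode_NG (P := P) (t := t) (v := v) (by rw [hv.mode, hvm])
    rw [h1]
    exact ⟨h4, by rw [h5, hv.rc]; exact hv1, by rw [h6, hv.next]; exact hv2⟩

theorem IsRun.eventually_contest (hP : P.Valid) (h : P.IsRun σ) :
    ∀ᶠ k in atTop, P.Contest (σ k) := by
  obtain ⟨K, hK⟩ := eventually_atTop.1 (h.eventually_steady hP)
  obtain ⟨k, hk, hg⟩ := h.exists_game_eq_none K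
  refine eventually_atTop.2 ⟨k, fun j hj => ?_⟩
  induction j, hj using Nat.le_induction with
  | base => intro g hg'; simp [hg] at hg'
  | succ j hj ih => exact (hK j (hk.trans hj)).contest hP ih

theorem StartNoIdling.frame {v : Fin N} (h : P.StartNoIdling v s s') :
    s'.rc = s.rc ∧ s'.next = s.next := by
  obtain ⟨-, -, -, -, -, -, -, -, -, rfl⟩ := h
  exact ⟨rfl, rfl⟩

/-- Robots with an incomplete task do not lose it except for another incomplete one. -/
theorem Steady.busy (hP : P.Valid) (h : P.Steady s s') (hc : P.Contest s) (i : Fin N)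
    (hi : P.nU s (s.rc i) ≠ 0) : P.nU s' (s'.rc i) ≠ 0 := by
  obtain ⟨s1, s2, t, hv⟩ := h.exists_via hP
  rw [h.nU_eq hP]
  have hd : ¬ P.TaskDone t i := fun hd => hi (by rw [← hv.nU, ← hv.rc]; exact hd.2)
  have hrc : (P.eventPhase t).rc i = s.rc i := by rw [eventPhase_rc P t hd, hv.rc]
  rcases h.game_cases hv with ⟨hs, v, h1⟩ | ⟨hs, -, h1⟩ | ⟨g1, hs, h1 | ⟨g2, hcy, h1⟩⟩
  · rwa [h1.frame.1, hrc]
  · rwa [h1, hrc]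
  · rw [h1]
    simp only [endGame]
    split_ifs with h2
    · have hg : (P.eventPhase t).game = some g1 := hv.game.trans hs
      exact (hc g1 hs).2 _ (hv.team.eventPhase.act_mem g1 hg h2.2.2.1 i h2.1)
    · rwa [hrc]
  · rw [h1]
    simpa only [hrc] using hi

/-- If there were actions, the trigger of the game would pass at once from a completed task to an
incomplete one, since it has nothing to finish first. This would enlarge the set of robots with an
incomplete task, against `hb`. -/
theorem Steady.actions_eq_empty (hP : P.Valid) (h : P.Steady s s') (hc : P.Contest s)
    (hb : ∀ i, P.nU s' (s'.rc i) ≠ 0 → P.nU s (s.rc i) ≠ 0) {s₁ s₂ t : State N M m}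
    (hv : P.Via s s₁ s₂ t s') {g : Game N M} (hg : s.game = some g)
    (he : s' = P.endGame (P.eventPhase t) g) : g.actions = ∅ := by
  by_contra hne
  obtain ⟨⟨v, hvp, hvm, hv1, hv2⟩, ha⟩ := hc g hg
  obtain ⟨h4, h5, h6⟩ := eventPhase_of_mode_NG (P := P) (t := t) (v := v) (by rw [hv.mode, hvm])
  refine hb v ?_ hv1
  rw [h.nU_eq hP]
  apply ha
  have hd : ¬ P.Defers (P.eventPhase t) g v := by
    rintro ⟨-, h7, -⟩
    have : P.nU (P.eventPhase t) = P.nU s := hv.nU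
    rw [this, h5, hv.rc, hv1] at h7
    exact lt_irrefl _ h7
  have hrc : s'.rc v = g.act v := by
    rw [he]
    exact if_pos ⟨hvp, by simp [h4], Finset.nonempty_iff_ne_empty.2 hne, hd⟩
  rw [hrc]
  exact hv.team.eventPhase.act_mem g (hv.game.trans hg) (Finset.nonempty_iff_ne_empty.2 hne) v hvp

theorem endGame_of_actions_eq_empty {g : Game N M} (h : g.actions = ∅) :
    (P.endGame s g).rc = s.rc ∧ (P.endGame s g).next = s.next := by
  constructor <;> funext i <;> simp [endGame, h]

theorem Steady.next_eq_none (hP : P.Valid) (h : P.Steady s s') (hc : P.Contest s)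
    (hb : ∀ i, P.nU s' (s'.rc i) ≠ 0 → P.nU s (s.rc i) ≠ 0) (i : Fin N) (hi : s.next i = none) :
    s'.next i = none := by
  obtain ⟨s1, s2, t, hv⟩ := h.exists_via hP
  have hn : (P.eventPhase t).next i = none := by
    by_cases hd : P.TaskDone t i
    · exact eventPhase_next_of_done hd
    · rw [eventPhase_next P t hd, hv.next, hi]
  rcases h.game_cases hv with ⟨hs, v, h1⟩ | ⟨hs, -, h1⟩ | ⟨g1, hs, h1 | ⟨g2, hcy, h1⟩⟩
  · rw [h1.frame.2, hn]
  · rw [h1, hn]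
  · have := h.actions_eq_empty hP hc hb hv hs h1
    rw [h1, (endGame_of_actions_eq_empty this).2, hn]
  · rw [h1, ← hn]

/-- After the event phase, only the end of a game can send a robot back to `WK`; as this game has no
actions, a player without work becomes idle instead. -/
theorem Steady.jobless_of_eventPhase (hP : P.Valid) (h : P.Steady s s') (hc : P.Contest s)
    (hb : ∀ i, P.nU s' (s'.rc i) ≠ 0 → P.nU s (s.rc i) ≠ 0) {s₁ s₂ t : State N M m}
    (hv : P.Via s s₁ s₂ t s') {i : Fin N} (hi : P.Jobless (P.eventPhase t) i) :
    P.Jobless s' i := by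
  have hn : P.nU s' = P.nU (P.eventPhase t) := hv.game_phase.nU_eq
  obtain ⟨h1, h2, h3⟩ := hi
  unfold Jobless
  rw [hn]
  rcases h.game_cases hv with ⟨hs, v, h4⟩ | ⟨hs, -, h4⟩ | ⟨g1, hs, h4 | ⟨g2, hcy, h4⟩⟩
  · rw [h4.frame.1, h4.frame.2]
    refine ⟨?_, h2, h3⟩
    obtain ⟨hm, S, q, a, act, hS, hpl, hact, -, rfl⟩ := h4
    by_cases hq : i ∈ q
    · simp [hq, StartNoIdling.mode_players hm hS hpl hq]
    · simpa only [if_neg hq] using h1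
  · rw [h4]; exact ⟨h1, h2, h3⟩
  · have ha := h.actions_eq_empty hP hc hb hv hs h4
    rw [h4, (endGame_of_actions_eq_empty ha).2, (endGame_of_actions_eq_empty ha).1]
    refine ⟨?_, h2, h3⟩
    rcases endGame_mode_cases hv.team.eventPhase (hv.game.trans hs) i with
      ⟨-, -, -, -, -, h5⟩ | ⟨-, -, h5, -⟩ | ⟨-, h5⟩
    · simp [h5]
    · exact absurd ⟨ha, h2, h3⟩ h5
    · rwa [h5]
  · rw [h4]; exact ⟨h1, h2, h3⟩

theorem Steady.jobless (hP : P.Valid) (h : P.Steady s s') (hc : P.Contest s)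
    (hb : ∀ i, P.nU s' (s'.rc i) ≠ 0 → P.nU s (s.rc i) ≠ 0) (i : Fin N) (hi : P.Jobless s i) :
    P.Jobless s' i := by
  obtain ⟨s1, s2, t, hv⟩ := h.exists_via hP
  refine h.jobless_of_eventPhase hP hc hb hv ?_
  obtain ⟨h1, h2, h3⟩ := hi
  rw [← hv.mode] at h1
  have hd : ¬ P.TaskDone t i := fun hd => h1 hd.1
  refine ⟨?_, ?_, ?_⟩
  · rcases P.eventPhase_mode_cases t i with ⟨h4, -⟩ | ⟨h4, -⟩ | ⟨-, -, h4⟩ | ⟨-, -, -, h4⟩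
    · exact absurd (hv.mode ▸ h4) (h.started i)
    · exact absurd h4 hd
    · simp [h4]
    · rwa [h4]
  · rw [eventPhase_rc P t hd, hv.rc, ← h2]
    exact congrFun hv.nU _
  · rw [eventPhase_next P t hd, hv.next, h3]

theorem Steady.mode_NG_of_eventPhase (hP : P.Valid) (h : P.Steady s s') (hc : P.Contest s)
    (hb : ∀ i, P.nU s' (s'.rc i) ≠ 0 → P.nU s (s.rc i) ≠ 0)
    (hj : ∀ i, P.Jobless s' i → P.Jobless s i) {s₁ s₂ t : State N M m}
    (hv : P.Via s s₁ s₂ t s') {i : Fin N} (hi : (P.eventPhase t).mode i = NG) :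
    s.mode i = NG := by
  rcases P.eventPhase_mode_cases t i with ⟨-, h4⟩ | ⟨h4, h5, h6⟩ | ⟨-, -, h4⟩ | ⟨-, -, -, h4⟩
  · simp [hi] at h4
  · have : P.Jobless (P.eventPhase t) i := by
      refine ⟨by simp [h6], ?_, eventPhase_next_of_done h4⟩
      rw [eventPhase_rc_of_done h4, h5]
      exact h4.2
    have := (hj i (h.jobless_of_eventPhase hP hc hb hv this)).1
    rw [← hv.mode] at this
    exact absurd h4.1 this
  · simp [hi] at h4
  · rw [← hv.mode, ← h4, hi]

/-- A robot enters `NG` either by being called, and is then a player, or by completing its task,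
which would create a new jobless robot against `hj`. So waiting robots can only become fewer. -/
theorem Steady.waiting (hP : P.Valid) (h : P.Steady s s') (hc : P.Contest s)
    (hb : ∀ i, P.nU s' (s'.rc i) ≠ 0 → P.nU s (s.rc i) ≠ 0)
    (hj : ∀ i, P.Jobless s' i → P.Jobless s i) (i : Fin N) (hi : Waiting s' i) : Waiting s i := by
  obtain ⟨s1, s2, t, hv⟩ := h.exists_via hP
  have key := fun i => h.mode_NG_of_eventPhase hP hc hb hj hv (i := i)
  obtain ⟨h1, h2⟩ := hi
  rcases h.game_cases hv with ⟨hs, v, h4⟩ | ⟨hs, -, h4⟩ | ⟨g1, hs, h4 | ⟨g2, hcy, h4⟩⟩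
  · refine ⟨key i ?_, by simp [hs]⟩
    obtain ⟨hm, S, q, a, act, hS, hpl, hact, -, rfl⟩ := h4
    have hq : i ∉ q := h2 _ rfl
    simpa only [if_neg hq] using h1
  · exact ⟨key i (h4 ▸ h1), by simp [hs]⟩
  · rw [h4] at h1
    rcases endGame_mode_cases hv.team.eventPhase (hv.game.trans hs) i with
      ⟨-, -, -, -, -, h5⟩ | ⟨-, -, -, h5⟩ | ⟨h6, h5⟩
    · simp [h5] at h1
    · simp [h5] at h1
    · rw [h5] at h1
      refine ⟨key i h1, fun g hg hm => h6 ?_⟩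
      rw [hs, Option.some.injEq] at hg
      subst hg
      exact ⟨hm, by simp [h1]⟩
  · rw [h4] at h1 h2
    refine ⟨key i h1, fun g hg hm => h2 g2 rfl ?_⟩
    rw [hs, Option.some.injEq] at hg
    subst hg
    rwa [hcy.players.1]

/-- A starting game makes its trigger a player and thus removes it from the waiting robots, against
`hw`. -/
theorem Steady.game_eq_none (hP : P.Valid) (h : P.Steady s s') (hc : P.Contest s)
    (hb : ∀ i, P.nU s' (s'.rc i) ≠ 0 → P.nU s (s.rc i) ≠ 0)
    (hj : ∀ i, P.Jobless s' i → P.Jobless s i) (hw : ∀ i, Waiting s i → Waiting s' i)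
    (hg : s.game = none) {s₁ s₂ t : State N M m} (hv : P.Via s s₁ s₂ t s') :
    (¬ ∃ s₃, P.Trigger (P.eventPhase t) s₃) ∧ s' = P.eventPhase t := by
  rcases h.game_cases hv with ⟨-, v, h4⟩ | ⟨-, h4⟩ | ⟨g1, hs, -⟩
  · obtain ⟨hm, S, q, a, act, hS, hpl, hact, -, rfl⟩ := h4
    have := hw v ⟨h.mode_NG_of_eventPhase hP hc hb hj hv hm, by simp [hg]⟩
    exact absurd (by simp [newGame, hpl]) (this.2 _ rfl)
  · exact h4
  · simp [hg] at hs

/-- A steady step without games or supervisor events. -/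
structure Static (P : Mission N M m) (s s₁ s₂ t s' : State N M m) : Prop where
  steady : P.Steady s s'
  via : P.Via s s₁ s₂ t s'
  no_trigger : ¬ ∃ s₃, P.Trigger (P.eventPhase t) s₃
  eq : s' = P.eventPhase t
  game : s.game = none
  not_done : ∀ i, ¬ P.TaskDone t i

theorem IsRun.eventually_static (hP : P.Valid) (h : P.IsRun σ) :
    ∀ᶠ k in atTop, ∃ s₁ s₂ t, P.Static (σ k) s₁ s₂ t (σ (k + 1)) := by
  have hs := h.eventually_steady hP
  have hc := h.eventually_contest hP
  have hb : ∀ᶠ k in atTop, ∀ i,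
      P.nU (σ (k + 1)) ((σ (k + 1)).rc i) ≠ 0 → P.nU (σ k) ((σ k).rc i) ≠ 0 :=
    eventually_imp_of_eventually_imp (p := fun k i => P.nU (σ k) ((σ k).rc i) ≠ 0) (by
      filter_upwards [hs, hc] with k hs hc using hs.busy hP hc)
  have hx : ∀ᶠ k in atTop, ∀ i, (σ (k + 1)).next i = none → (σ k).next i = none :=
    eventually_imp_of_eventually_imp (p := fun k i => (σ k).next i = none) (by
      filter_upwards [hs, hc, hb] with k hs hc hb using hs.next_eq_none hP hc hb)
  have hj : ∀ᶠ k in atTop, ∀ i, P.Jobless (σ (k + 1)) i → P.Jobless (σ k) i :=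
    eventually_imp_of_eventually_imp (p := fun k i => P.Jobless (σ k) i) (by
      filter_upwards [hs, hc, hb] with k hs hc hb using hs.jobless hP hc hb)
  have hw : ∀ᶠ k in atTop, ∀ i, ¬ Waiting (σ (k + 1)) i → ¬ Waiting (σ k) i :=
    eventually_imp_of_eventually_imp (p := fun k i => ¬ Waiting (σ k) i) (by
      filter_upwards [hs, hc, hb, hj] with k hs hc hb hj i using mt (hs.waiting hP hc hb hj i))
  obtain ⟨K, hK⟩ := eventually_atTop.1 (hs.and (hc.and (hb.and (hx.and (hj.and hw)))))
  obtain ⟨k0, hk0, hg0⟩ := h.exists_game_eq_none K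
  have key : ∀ k, k0 ≤ k → (σ k).game = none → ∃ s₁ s₂ t, P.Static (σ k) s₁ s₂ t (σ (k + 1)) := by
    intro k hk hg
    obtain ⟨hs, hc, hb, hx, hj, hw⟩ := hK k (hk0.trans hk)
    obtain ⟨s1, s2, t, hv⟩ := hs.exists_via hP
    obtain ⟨h1, h2⟩ := hs.game_eq_none hP hc hb hj (fun i => not_imp_not.1 (hw i)) hg hv
    refine ⟨s1, s2, t, hs, hv, h1, h2, hg, fun i hd => ?_⟩
    -- Completing a task clears `next`; as no robot newly acquires `next = none`, it was already
    -- `none`. The robot then leaves `WK` and becomes jobless, which is excluded too.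
    have hn : (σ k).next i = none := hx i (by rw [h2]; exact eventPhase_next_of_done hd)
    have : P.Jobless (σ (k + 1)) i := by
      rw [h2]
      refine ⟨?_, ?_, eventPhase_next_of_done hd⟩
      · rcases P.eventPhase_mode_cases t i with ⟨h4, -⟩ | ⟨-, -, h6⟩ | ⟨-, -, h4⟩ | ⟨-, h4, -⟩
        · simp [hd.1] at h4
        · simp [h6]
        · simp [h4]
        · exact absurd ⟨hd, hv.next ▸ hn⟩ h4
      · rw [eventPhase_rc_of_done hd, hv.next, hn]
        exact hd.2
    have := (hj i this).1
    rw [← hv.mode] at this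
    exact this hd.1
  have hgame : ∀ k, k0 ≤ k → (σ k).game = none := by
    intro k hk
    induction k, hk using Nat.le_induction with
    | base => exact hg0
    | succ k hk ih =>
      obtain ⟨s1, s2, t, hst⟩ := key k hk ih
      rw [hst.eq]
      exact hst.via.game.trans ih
  exact eventually_atTop.2 ⟨k0, fun k hk => key k hk (hgame k hk)⟩

end

/-! ### Progress in the regime without games, and the conclusion. -/

section

variable {N M m : ℕ} {P : Mission N M m} {s s₁ s₂ t s' : State N M m}

/-! ### The static regime -/

theorem exists_startNoIdling {v : Fin N} (hv : s.mode v = NG) : ∃ s', P.StartNoIdling v s s' := by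
  obtain ⟨S, hS⟩ := P.exists_nearest s P.kappa1 v
    (Finset.univ.filter fun i => s.mode i = WK ∨ s.mode i = ID ∨ s.mode i = NG)
  by_cases hne : (Finset.univ.filter fun r => ENNReal.ofReal P.gamma ≤ P.tc s r).Nonempty
  · obtain ⟨r, hr⟩ := hne
    exact ⟨_, hv, S, _, _, fun _ => r, hS, rfl, rfl, fun _ _ _ => hr, rfl⟩
  · exact ⟨_, hv, S, _, _, s.rc, hS, rfl, rfl, fun h => absurd h hne, rfl⟩

/-- If nobody can take over, robot `i`, which is not `f` because it is alive, and `kappa2 > 0` make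
the set of players nonempty. -/
theorem exists_trigger_of_pendingFailure (hP : P.Valid) {f i : Fin N} (hf : P.PendingFailure s f)
    (hi : s.mode i = WK ∨ s.mode i = ID) : ∃ s', P.Trigger s s' := by
  by_cases he : (P.engaged s (s.rc f)).Nonempty
  · exact ⟨_, Or.inr (Or.inr ⟨f, hf, he, rfl⟩)⟩
  · obtain ⟨S, hS⟩ := P.exists_nearest s P.kappa2 f
      (Finset.univ.filter fun i => s.mode i = WK ∨ s.mode i = ID)
    have hne : S.Nonempty := by
      rw [← Finset.card_pos, hS.2.1]
      refine lt_min hP.kappa2_pos (Finset.card_pos.2 ⟨i, Finset.mem_erase.2 ⟨?_, by simpa using hi⟩⟩)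
      rintro rfl
      simp [hf.1.1] at hi
    refine ⟨_, Or.inr (Or.inl ⟨f, hf, he, S, insert (s.rc f)
      ((S.image s.rc).filter fun r => ENNReal.ofReal P.eta < P.tc s r),
      fun j => if s.rc j ∈ insert (s.rc f)
        ((S.image s.rc).filter fun r => ENNReal.ofReal P.eta < P.tc s r) then s.rc j else s.rc f,
      hne, hS, rfl, fun j _ => ⟨?_, fun h => if_pos h⟩, rfl⟩)⟩
    dsimp only
    split_ifs with h
    · exact h
    · exact Finset.mem_insert_self _ _

namespace Static

variable (h : P.Static s s₁ s₂ t s')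
include h

theorem mode_eq : s'.mode = s.mode := by
  funext i
  rw [h.eq, ← h.via.mode]
  rcases P.eventPhase_mode_cases t i with ⟨h1, -⟩ | ⟨h1, -⟩ | ⟨h1, -, h2⟩ | ⟨-, -, -, h1⟩
  · exact absurd (h.via.mode ▸ h1) (h.steady.started i)
  · exact absurd h1 (h.not_done i)
  · have := h.steady.stopped i (by rw [h.eq, h2])
    rw [← h.via.mode, h1] at this
    cases this
  · exact h1

theorem rc_eq : s'.rc = s.rc := by
  funext i
  rw [h.eq, eventPhase_rc P t (h.not_done i), h.via.rc]

theorem mode_ne_NG (i : Fin N) : s.mode i ≠ NG := by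
  intro hi
  obtain ⟨s₃, hs⟩ := exists_startNoIdling (P := P) (s := P.eventPhase t) (v := i)
    (by rw [← h.eq, h.mode_eq, hi])
  exact h.no_trigger ⟨s₃, Or.inl ⟨i, hs⟩⟩

theorem mode_ne_RG (i : Fin N) : s.mode i ≠ RG := by
  intro hi
  obtain ⟨g, hg, -⟩ := h.steady.inv.team.resil i hi
  simp [h.game] at hg

theorem nU_ne_zero {i : Fin N} (hi : s.mode i = WK) : P.nU s (s.rc i) ≠ 0 := by
  intro h0
  refine h.not_done i ⟨by rw [h.via.mode, hi], ?_⟩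
  rw [h.via.nU, h.via.rc, h0]

/-- A working robot would have a completed task, and an idle one would stop; both contradict the
absence of events. -/
theorem terminal_of_nU_eq_zero (h0 : ∀ r, P.nU s r = 0) (i : Fin N) :
    s.mode i = SP ∨ s.mode i = FL := by
  have h1 := h.mode_ne_NG i
  have h2 := h.mode_ne_RG i
  have h3 := h.steady.started i
  have h4 : s.mode i ≠ WK := fun hi => h.nU_ne_zero hi (h0 _)
  have h5 : s.mode i ≠ ID := by
    intro hi
    have := h.mode_eq ▸ hi
    rw [h.eq] at this
    rcases P.eventPhase_mode_cases t i with ⟨-, h1⟩ | ⟨-, -, h1⟩ | ⟨-, -, h1⟩ | ⟨-, -, h1, -⟩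
    · simp [this] at h1
    · simp [this] at h1
    · simp [this] at h1
    · exact h1 ⟨by rw [h.via.mode, hi], fun r => by rw [h.via.nU, h0]⟩
  cases hm : s.mode i <;> simp_all

/-- The witness of `alert` is at work or an open failure. The latter is confirmed by now and would
trigger the optimizer, because the live robot `ℓ` can only be in `WK` or `ID`. -/
theorem exists_working (hP : P.Valid) {ℓ : Fin N} (hℓ : s.mode ℓ ≠ FL) {r : Fin M}
    (hr : P.nU s r ≠ 0) : ∃ i, s.mode i = WK := by
  obtain ⟨f, hf | (hf | hf | hf) | ⟨hf, hf2⟩⟩ := h.steady.inv.team.alert r hr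
  · exact absurd hf (h.steady.started f)
  · exact ⟨f, hf⟩
  · exact absurd hf (h.mode_ne_NG f)
  · exact absurd hf (h.mode_ne_RG f)
  · exfalso
    refine h.no_trigger (exists_trigger_of_pendingFailure hP (f := f) (i := ℓ) ⟨⟨?_, ?_⟩, ?_⟩ ?_)
    · rw [← h.eq, h.mode_eq, hf]
    · exact (h.via.confirmed f (h.via.mode ▸ hf)).2
    · rw [← h.eq, h.steady.handled]; exact hf2
    · rw [← h.eq, h.mode_eq]
      have h1 := h.mode_ne_NG ℓ
      have h2 := h.mode_ne_RG ℓ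
      have h3 := h.steady.started ℓ
      have h4 : s.mode ℓ ≠ SP := fun hi => hr (h.steady.inv.team.stopped ℓ hi r)
      cases hm : s.mode ℓ <;> simp_all

theorem frame₁ : s₁.rc = s.rc ∧ s₁.pos = s.pos ∧ s₁.sub = s.sub ∧ s₁.explored = s.explored ∧
    s₁.detected = s.detected ∧ s₁.wp = s.wp := by
  obtain ⟨F, rfl⟩ := h.via.fail
  exact ⟨rfl, rfl, rfl, rfl, rfl, rfl⟩

theorem frame₂ : s₂.rc = s.rc ∧ s₂.pos = s.pos ∧ s₂.explored = s.explored ∧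
    s₂.detected = s.detected ∧ s₂.wp = s.wp ∧ s₂.mode = s.mode := by
  obtain ⟨h1, h2, -, h3, h4, h5⟩ := h.frame₁
  have h6 := h.via.mode₁
  obtain ⟨sub', rfl, -⟩ := h.via.claim
  exact ⟨h1, h2, h3, h4, h5, h6⟩

theorem mem_engaged {r : Fin M} {i : Fin N} :
    i ∈ P.engaged s₁ r ↔ s.mode i = WK ∧ s.rc i = r := by
  rw [engaged, Finset.mem_filter, h.frame₁.1, OnDuty, h.via.mode₁]
  have h1 := h.mode_ne_NG i
  have h2 := h.mode_ne_RG i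
  have h3 : s.mode i = FL → P.FailureConfirmed s₁ i :=
    fun hi => h.via.confirmed₁ i (h.via.mode₁ ▸ hi)
  simp only [Finset.mem_univ, true_and]
  tauto

theorem sole_iff {i : Fin N} : P.Sole s₁ i ↔ ∀ j, s.mode j = WK → s.rc j = s.rc i → j = i := by
  simp only [Sole, h.mem_engaged, h.frame₁.1, and_imp]

theorem sole_iff_sole : P.Sole s₂ = P.Sole s₁ := by
  obtain ⟨sub', rfl, -⟩ := h.via.claim
  rfl

theorem unexploredCount_eq₁ : P.unexploredCount s₁ = P.unexploredCount s := by
  obtain ⟨F, rfl⟩ := h.via.fail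
  rfl

theorem unexplored_eq (hP : P.Valid) : P.Unexplored s' = P.Unexplored s :=
  h.steady.inv.map.unexplored_congr hP h.steady.inv'.map h.steady.explored h.steady.detected

theorem unexploredCount_eq (hP : P.Valid) : P.unexploredCount s' = P.unexploredCount s :=
  h.steady.inv.map.unexploredCount_congr hP h.steady.inv'.map h.steady.explored h.steady.detected

theorem sub_eq : s'.sub = s₂.sub := by
  have hn := h.not_done
  funext i
  rw [h.eq]
  refine (if_neg (hn i)).trans ?_
  obtain ⟨wp, pos, tasked, d, -, -, rfl⟩ := h.via.move
  rfl

theorem acts (i : Fin N) : P.Acts s₂ i (s'.wp i) (s'.pos i) (s'.tasked i) := by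
  rw [h.eq]
  obtain ⟨wp, pos, tasked, d, ha, -, rfl⟩ := h.via.move
  exact ha i

/-- A robot keeps an unfinished sub-region. -/
theorem sub_eq_some {i : Fin N} {q : Fin m} (hns : ¬ P.Sole s₁ i) (hq : s.sub i = some q)
    (hc : P.unexploredCount s (P.subCells (s.rc i) q) ≠ 0) : s'.sub i = some q := by
  rw [h.sub_eq]
  obtain ⟨h1, -, h2, -⟩ := h.frame₁
  have h3 := h.unexploredCount_eq₁
  obtain ⟨sub', rfl, h4, -⟩ := h.via.claim
  have : i ∉ P.claimants s₁ (s₁.rc i) := by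
    intro hm
    have := (Finset.mem_filter.1 hm).2.2.2.2 q (by rw [h2, hq])
    rw [h3, h1] at this
    exact hc this
  refine (h4 i this).trans ?_
  rw [if_neg (fun h => hns h.2.1), h2, hq]

/-- When no robot of a shared task has an unfinished sub-region, one of them claims one. -/
theorem exists_claim {i : Fin N} (hi : s.mode i = WK) (hns : ¬ P.Sole s₁ i)
    (hno : ∀ j q, s.mode j = WK → s.rc j = s.rc i → s.sub j = some q →
      P.unexploredCount s (P.subCells (s.rc i) q) = 0) :
    ∃ j q, s.mode j = WK ∧ s.rc j = s.rc i ∧ s'.sub j = some q ∧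
      P.unexploredCount s (P.subCells (s.rc i) q) ≠ 0 := by
  rw [h.sub_eq]
  obtain ⟨h1, -, h2, -⟩ := h.frame₁
  have h3 := h.unexploredCount_eq₁
  have hm := h.via.mode₁
  have he := fun j => h.mem_engaged (r := s.rc i) (i := j)
  obtain ⟨c, hc, hcu⟩ := nU_pos_iff.1 (h.nU_ne_zero hi)
  obtain ⟨sub', rfl, -, h4⟩ := h.via.claim
  have hr := h4 (s.rc i)
  have hcl : (P.claimants s₁ (s.rc i)).Nonempty := by
    refine ⟨i, Finset.mem_filter.2 ⟨Finset.mem_univ _, hm ▸ hi, by rw [h1], hns, fun q hq => ?_⟩⟩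
    rw [h3]
    exact hno i q hi rfl (h2 ▸ hq)
  have hcnt : P.unexploredCount s (P.subCells (s.rc i) (P.subOf c)) ≠ 0 := by
    rw [unexploredCount, ← Nat.pos_iff_ne_zero, Finset.card_pos]
    exact ⟨c, Finset.mem_filter.2 ⟨Finset.mem_filter.2 ⟨hc, rfl⟩, hcu⟩⟩
  -- The sub-region of an unexplored cell of the task is incomplete, and by `hno` no engaged robot
  -- holds it.
  have hfr : (P.freeSubs s₁ (s.rc i)).Nonempty := by
    refine ⟨P.subOf c, Finset.mem_filter.2 ⟨Finset.mem_univ _, ?_, fun j hj hs => ?_⟩⟩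
    · rw [h3]; exact Nat.pos_of_ne_zero hcnt
    · obtain ⟨h5, h6⟩ := (he j).1 hj
      exact hcnt (hno j _ h5 h6 (h2 ▸ hs))
  rw [if_pos ⟨hcl, hfr⟩] at hr
  obtain ⟨j, hj, -, ⟨q, hq, hjq, -⟩, -⟩ := hr
  have hj := (Finset.mem_filter.1 hj).2
  have hq := (Finset.mem_filter.1 hq).2.1
  rw [h3] at hq
  exact ⟨j, q, hm ▸ hj.1, h1 ▸ hj.2.1, hjq, hq.ne'⟩

theorem region_of_sole {i : Fin N} (hs : P.Sole s₁ i) : P.region s₂ i = P.taskCells (s.rc i) := by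
  rw [← h.sole_iff_sole] at hs
  rw [region, if_pos hs, h.frame₂.1]

theorem region_of_not_sole {i : Fin N} (hs : ¬ P.Sole s₁ i) {q : Fin m} (hq : s'.sub i = some q) :
    P.region s₂ i = P.subCells (s.rc i) q := by
  rw [← h.sole_iff_sole] at hs
  rw [h.sub_eq] at hq
  rw [region, if_neg hs, h.frame₂.1, hq]

theorem mem_eligible (hP : P.Valid) {i : Fin N} {c : Cell} :
    c ∈ P.eligible s₂ i ↔ c ∈ P.region s₂ i ∧ P.Unexplored s c := by
  obtain ⟨-, h2, h3, h4, -⟩ := h.frame₂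
  rw [h.steady.inv.map.unexplored_iff hP i, eligible, Finset.mem_filter, h2, h3, h4, openGraph,
    openGraph, h4]

theorem exists_waypoint (hP : P.Valid) {i : Fin N} (hi : s.mode i = WK)
    (hR : P.unexploredCount s (P.region s₂ i) ≠ 0) :
    ∃ c ∈ P.region s₂ i, P.Unexplored s c ∧ s'.wp i = some c := by
  have ha := h.acts i
  rw [unexploredCount, ← Nat.pos_iff_ne_zero, Finset.card_pos] at hR
  obtain ⟨c, hc⟩ := hR
  have hne : (P.eligible s₂ i).Nonempty := ⟨c, (h.mem_eligible hP).2 (Finset.mem_filter.1 hc)⟩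
  rw [Acts, if_pos ⟨by rw [h.frame₂.2.2.2.2.2, hi], hne⟩] at ha
  obtain ⟨d, hd, hwp, -⟩ := ha
  obtain ⟨h1, h2⟩ := (h.mem_eligible hP).1 hd.1
  exact ⟨d, h1, h2, hwp⟩

/-- A robot gets closer to its waypoint. -/
theorem dist_waypoint (hP : P.Valid) {i : Fin N} (hi : s.mode i = WK) {c : Cell}
    (hc : c ∈ P.region s₂ i) (hu : P.Unexplored s c) (hwp : s.wp i = some c) :
    s'.wp i = some c ∧ (P.openGraph s').dist (s'.pos i) c < (P.openGraph s).dist (s.pos i) c := by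
  have ha := h.acts i
  have he : c ∈ P.eligible s₂ i := (h.mem_eligible hP).2 ⟨hc, hu⟩
  obtain ⟨-, h2, -, h4, h5, h6⟩ := h.frame₂
  have hg : P.openGraph s₂ = P.openGraph s := by rw [openGraph, openGraph, h4]
  have hg' : P.openGraph s' = P.openGraph s := by rw [openGraph, openGraph, h.steady.detected]
  rw [Acts, if_pos ⟨by rw [h6, hi], c, he⟩] at ha
  obtain ⟨d, ⟨-, hd⟩, hwp', hact⟩ := ha
  rw [if_pos ⟨c, he, by rw [h5, hwp]⟩, h5, hwp, Option.some.injEq] at hd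
  subst hd
  refine ⟨hwp', ?_⟩
  rw [h2, hg] at hact
  rw [hg']
  split_ifs at hact with hcp
  -- At its waypoint the robot would explore it, but the explored set does not change.
  · exfalso
    apply hu.1
    rw [← h.steady.explored, h.steady.step.explored_eq]
    refine Finset.mem_union_right _ (Finset.mem_filter.2 ⟨?_, i, hact.2⟩)
    rw [hcp]
    exact (Finset.mem_filter.1 (h.steady.inv.map.pos_mem i)).1
  · have := hact.2.2
    omega

end Static

/-- A working robot cannot keep its region and make no progress for ever. -/
theorem not_static_of_region (hP : P.Valid) {τ a b c : ℕ → State N M m}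
    (h : ∀ k, P.Static (τ k) (a k) (b k) (c k) (τ (k + 1))) {i : Fin N} {R : Finset Cell} {K : ℕ}
    (hi : ∀ k, (τ k).mode i = WK) (hR : ∀ k, K ≤ k → P.region (b k) i = R)
    (hu : P.unexploredCount (τ K) R ≠ 0) : False := by
  obtain ⟨d, hd, hdu, hwp⟩ := (h K).exists_waypoint hP (hi K) (by rwa [hR K le_rfl])
  rw [hR K le_rfl] at hd
  -- Infinite descent on the distance to the waypoint, which is fixed from time `K + 1` on.
  have key : ∀ n k, K < k → P.Unexplored (τ k) d → (τ k).wp i = some d →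
      (P.openGraph (τ k)).dist ((τ k).pos i) d = n → False := by
    intro n
    induction n using Nat.strong_induction_on with
    | _ n ih =>
      intro k hk hu hw hn
      obtain ⟨h1, h2⟩ := (h k).dist_waypoint hP (hi k) (by rwa [hR k hk.le]) hu hw
      exact ih _ (hn ▸ h2) (k + 1) (by omega) (by rwa [(h k).unexplored_eq hP]) h1 rfl
  exact key _ (K + 1) (by omega) (by rwa [(h K).unexplored_eq hP]) hwp rfl

/-- Either `i` is alone and its region is its whole task, or the task is shared and some robot on
it, not necessarily `i`, holds an unfinished sub-region for ever. Both cases contradict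
`not_static_of_region`. -/
theorem not_static_of_working (hP : P.Valid) {τ a b c : ℕ → State N M m}
    (h : ∀ k, P.Static (τ k) (a k) (b k) (c k) (τ (k + 1))) {i : Fin N}
    (hi : (τ 0).mode i = WK) : False := by
  have hmode : ∀ k, (τ k).mode = (τ 0).mode := by
    intro k
    induction k with
    | zero => rfl
    | succ k ih => rw [(h k).mode_eq, ih]
  have hrc : ∀ k, (τ k).rc = (τ 0).rc := by
    intro k
    induction k with
    | zero => rfl
    | succ k ih => rw [(h k).rc_eq, ih]
  have hcount : ∀ k, P.unexploredCount (τ k) = P.unexploredCount (τ 0) := by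
    intro k
    induction k with
    | zero => rfl
    | succ k ih => rw [(h k).unexploredCount_eq hP, ih]
  have hsole : ∀ k j, P.Sole (a k) j ↔
      ∀ l, (τ 0).mode l = WK → (τ 0).rc l = (τ 0).rc j → l = j := by
    intro k j
    rw [(h k).sole_iff, hmode, hrc]
  by_cases hs : P.Sole (a 0) i
  · refine not_static_of_region hP h (R := P.taskCells ((τ 0).rc i)) (K := 0)
      (fun k => by rw [hmode, hi]) (fun k _ => ?_) ((h 0).nU_ne_zero hi)
    rw [(h k).region_of_sole (by rw [hsole, ← hsole 0]; exact hs), hrc]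
  have hns : ∀ k j, (τ 0).rc j = (τ 0).rc i → ¬ P.Sole (a k) j := by
    intro k j hj hsj
    rw [hsole] at hsj hs
    apply hs
    intro l hl hli
    rw [hsj l hl (hli.trans hj.symm), hsj i hi hj.symm]
  obtain ⟨K, j, q, hj, hjr, hq, hc⟩ : ∃ K j q, (τ 0).mode j = WK ∧ (τ 0).rc j = (τ 0).rc i ∧
      (τ K).sub j = some q ∧ P.unexploredCount (τ 0) (P.subCells ((τ 0).rc i) q) ≠ 0 := by
    by_cases hex : ∃ j q, (τ 0).mode j = WK ∧ (τ 0).rc j = (τ 0).rc i ∧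
      (τ 0).sub j = some q ∧ P.unexploredCount (τ 0) (P.subCells ((τ 0).rc i) q) ≠ 0
    · exact ⟨0, hex⟩
    -- If no robot of the task holds an unfinished sub-region at time `0`, one claims it during the
    -- first step.
    · refine ⟨1, (h 0).exists_claim hi hs fun j q h1 h2 h3 => ?_⟩
      by_contra h4
      exact hex ⟨j, q, h1, h2, h3, h4⟩
  have hsub : ∀ k, K ≤ k → (τ k).sub j = some q := by
    intro k hk
    induction k, hk using Nat.le_induction with
    | base => exact hq
    | succ k hk ih =>
      refine (h k).sub_eq_some (hns k j hjr) ih ?_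
      rw [hcount, hrc, hjr]
      exact hc
  refine not_static_of_region hP h (i := j) (R := P.subCells ((τ 0).rc i) q) (K := K)
    (fun k => by rw [hmode, hj]) (fun k hk => ?_) (by rw [hcount]; exact hc)
  -- Claims precede motion, so the region used in step `k` is given by the sub-region held at time
  -- `k + 1`.
  rw [(h k).region_of_not_sole (hns k j hjr) (hsub (k + 1) (by omega)), hrc, hjr]

/-! ### The theorem -/

variable {σ : ℕ → State N M m}

theorem IsRun.explored_subset (h : P.IsRun σ) (K : ℕ) :
    ∀ c ∈ (σ K).explored, ∃ k ≤ K, ∃ i, (σ k).tasked i = some c := by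
  induction K with
  | zero =>
    intro c hc
    obtain ⟨-, -, -, -, -, -, -, -, -, -, he, -, -⟩ := h.1
    simp [he] at hc
  | succ K ih =>
    intro c hc
    rw [(h.2 K).explored_eq] at hc
    rcases Finset.mem_union.1 hc with hc | hc
    · obtain ⟨k, hk, hi⟩ := ih c hc
      exact ⟨k, by omega, hi⟩
    · exact ⟨K + 1, le_rfl, (Finset.mem_filter.1 hc).2⟩

/-- An allowed cell is never detected as blocked and is reachable from robot `i`; if not explored,
it would count in the `nU` of its task. -/
theorem IsRun.coversBy (hP : P.Valid) (h : P.IsRun σ) (i : Fin N) {K : ℕ}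
    (h0 : ∀ r, P.nU (σ K) r = 0) : P.CoversBy σ K := by
  intro x hx
  simp only [freeSpace, Set.mem_iUnion] at hx
  obtain ⟨c, hc, hx⟩ := hx
  have hinv := (h.inv hP K).map
  have hex : c ∈ (σ K).explored := by
    by_contra hne
    refine nU_pos_iff.2 ⟨c, ?_, hne, ?_, i, hinv.reachable hP (hinv.pos_mem i) hc⟩ (h0 (P.task c))
    · exact Finset.mem_filter.2 ⟨(Finset.mem_filter.1 hc).1, rfl⟩
    · exact fun hd => (hinv.detected_mem c hd).2 (Finset.mem_filter.1 hc).2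
  obtain ⟨k, hk, ℓ, hℓ⟩ := h.explored_subset K c hex
  simp only [Set.mem_iUnion]
  exact ⟨ℓ, k, by simpa using Nat.lt_succ_of_le hk, c, by simp [hℓ], hx⟩

theorem IsRun.exists_static_forever (hP : P.Valid) (h : P.IsRun σ) {ℓ : Fin N}
    (hℓ : ∀ k, (σ k).mode ℓ ≠ FL) :
    ∃ K, ∀ k, K ≤ k → (∀ r, P.nU (σ k) r = 0) ∧
      ∀ i, (σ k).mode i = SP ∨ (σ k).mode i = FL := by
  obtain ⟨K, hK⟩ := Filter.eventually_atTop.1 (h.eventually_static hP)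
  refine ⟨K, fun k hk => ?_⟩
  have hst : ∀ j, ∃ s₁ s₂ t, P.Static (σ (k + j)) s₁ s₂ t (σ (k + j + 1)) := fun j =>
    hK _ (by omega)
  choose a b c hst using hst
  have h0 : ∀ r, P.nU (σ k) r = 0 := by
    by_contra! hr
    obtain ⟨r, hr⟩ := hr
    obtain ⟨i, hi⟩ := (hst 0).exists_working hP (hℓ k) hr
    exact not_static_of_working hP (τ := fun j => σ (k + j)) hst hi
  exact ⟨h0, (hst 0).terminal_of_nU_eq_zero h0⟩

end

end Mission

end

end CARE

theorem mainTheorem2 {N M m : ℕ} (P : CARE.Mission N M m) (hP : P.Valid) :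
    (∃ s, P.Initial s) ∧ (∀ s, ∃ s₂, P.Step s s₂) ∧
    ∀ σ : ℕ → CARE.State N M m, P.IsRun σ →
      (∃ ℓ, ∀ k, (σ k).mode ℓ ≠ CARE.DState.FL) →
      ∃ K, P.CoversBy σ K ∧ (∑ r, P.nU (σ K) r = 0) ∧
        ∀ k, K ≤ k → ∀ ℓ, (σ k).mode ℓ = CARE.DState.SP ∨ (σ k).mode ℓ = CARE.DState.FL := by
  refine ⟨CARE.Mission.exists_initial hP, fun s => CARE.Mission.exists_step s hP, ?_⟩
  rintro σ hσ ⟨ℓ, hℓ⟩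
  obtain ⟨K, hK⟩ := hσ.exists_static_forever hP hℓ
  exact ⟨K, hσ.coversBy hP ℓ (hK K le_rfl).1, Finset.sum_eq_zero fun r _ => (hK K le_rfl).1 r,
    fun k hk => (hK k hk).2⟩
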